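/- Rings are associative with identity, modules are unital, and "module" means left module unless stated otherwise. Let $G$ be a finite group and let $R=\bigoplus_{g\in G}R_g$ be a $G$-graded ring ($R_gR_h\subseteq R_{gh}$); write $r_g$ for the $g$-component of $r\in R$. The smash product $R\#G$ is the free left $R$-module with basis $\{p_g : g\in G\}$ and multiplication determined by $(rp_g)(r'p_h)=r\,r'_{gh^{-1}}\,p_h$ for $r,r'\in R$ and $g,h\in G$; it is a ring with identity $\sum_{g\in G}p_g$. For a ring $S$ and integers $n,d\ge 0$, an $S$-module $M$ is finitely $n$-presented if there is an exact sequence $F_n\to\cdots\to F_1\to F_0\to M\to 0$ with all $F_i$ finitely generated projective. The ring $S$ is called - left coherent if every finitely generated left ideal of $S$ is finitely presented (right coherent is the same notion for right ideals); - Ding-Chen if it is left and right coherent and there is an integer $k\ge 0$ that is the $(1,0)$-injective dimension of $S$ both as a left and as a right module over itself, where the $(1,0)$-injective dimension of $M$ is the smallest integer $j\ge 0$ with $\operatorname{Ext}^{j+1}_S(F,M)=0$ for every finitely presented $F$; - left $n$-perfect if every flat $S$-module has projective dimension at most $n$; - a left $(n,d)$-ring if every finitely $n$-presented $S$-module has projective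 dimension at most $d$; - left $n$-coherent if every finitely $n$-presented $S$-module is finitely $(n+1)$-presented; - left regular coherent if it is left coherent and every finitely generated left ideal of $S$ has finite projective dimension. Then, for all integers $n,d\ge 0$: 1. $R$ is a left coherent ring if and only if $R\#G$ is a left coherent ring. 2. $R$ is a Ding-Chen ring if and only if $R\#G$ is a Ding-Chen ring. 3. If $R$ is a left $n$-perfect ring, then $R\#G$ is a left $n$-perfect ring. 4. If $R$ is a left $(n,d)$-ring, then $R\#G$ is a left $(n,d)$-ring. 5. If $R$ is a left $n$-coherent ring, then $R\#G$ is a left $n$-coherent ring. 6. If $R$ is a semisimple Artinian ring, then $R\#G$ is a semisimple Artinian ring. 7. If $R$ is a left regular coherent ring, then $R\#G$ is a left regular coherent ring. -/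

import Mathlib

/-! ### The smash product of a graded ring with a finite group

A `G`-graded ring for a (multiplicative, not necessarily commutative) group `G` is a ring `R` with
an internal grading `𝒜 : Additive G → AddSubgroup R`, `[GradedRing 𝒜]`, so that
`𝒜 (ofMul g) * 𝒜 (ofMul h) ⊆ 𝒜 (ofMul (g * h))` and `R` is the internal direct sum of the `𝒜 g`. -/

universe u v

/-- The `g`-component `r_g` of an element `r` of a `G`-graded ring. -/
def gradedComponent {R : Type u} {G : Type v} [Ring R] [Group G] [DecidableEq G]
    (𝒜 : Additive G → AddSubgroup R) [GradedRing 𝒜] (g : G) : R →+ R :=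
  GradedRing.proj 𝒜 (Additive.ofMul g)

/-- The smash product `R # G`: the free left `R`-module with basis `p_g`, `g ∈ G`. The element
`∑ g, x_g • p_g` is represented by its family of coefficients `g ↦ x_g`. -/
@[ext] structure SmashProduct {R : Type u} {G : Type v} [Ring R]
    (𝒜 : Additive G → AddSubgroup R) : Type (max u v) where
  /-- The coefficient of the basis element `p_g`. -/
  coeff : G → R

namespace SmashProduct

section Additive

variable {R : Type u} {G : Type v} [Ring R] (𝒜 : Additive G → AddSubgroup R)

/-- An element of the smash product is the same as its family of coefficients. -/
def coeffEquiv : SmashProduct 𝒜 ≃ (G → R) where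
  toFun := coeff
  invFun := mk
  left_inv _ := rfl
  right_inv _ := rfl

instance : AddCommGroup (SmashProduct 𝒜) := (coeffEquiv 𝒜).addCommGroup

instance : Module R (SmashProduct 𝒜) := (coeffEquiv 𝒜).module R

@[simp] theorem coeff_add (x y : SmashProduct 𝒜) : (x + y).coeff = x.coeff + y.coeff := rfl

@[simp] theorem coeff_zero : (0 : SmashProduct 𝒜).coeff = 0 := rfl

@[simp] theorem coeff_smul (r : R) (x : SmashProduct 𝒜) : (r • x).coeff = r • x.coeff := rfl

/-- The identity element `1 = ∑ g, p_g`. -/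
instance : One (SmashProduct 𝒜) where
  one := ⟨fun _ => 1⟩

theorem coeff_one (g : G) : (1 : SmashProduct 𝒜).coeff g = 1 := rfl

/-- The basis element `p_g`. -/
def p [DecidableEq G] (g : G) : SmashProduct 𝒜 := ⟨Pi.single g 1⟩

end Additive

section Components

variable {R : Type u} {G : Type v} [Ring R] [Group G] [DecidableEq G]
  (𝒜 : Additive G → AddSubgroup R) [GradedRing 𝒜]

theorem gradedComponent_mem (g : G) (r : R) :
    gradedComponent 𝒜 g r ∈ 𝒜 (Additive.ofMul g) := by
  rw [gradedComponent, GradedRing.proj_apply]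
  exact SetLike.coe_mem _

theorem gradedComponent_one (g : G) :
    gradedComponent 𝒜 g (1 : R) = if g = 1 then 1 else 0 := by
  rw [gradedComponent, GradedRing.proj_apply]
  split_ifs with h
  · subst h
    exact DirectSum.decompose_of_mem_same 𝒜 (SetLike.GradedOne.one_mem (A := 𝒜))
  · refine DirectSum.decompose_of_mem_ne 𝒜 (SetLike.GradedOne.one_mem (A := 𝒜)) ?_
    intro h0
    exact h (Additive.ofMul.injective h0.symm)

theorem sum_gradedComponent [Fintype G] (r : R) : ∑ g : G, gradedComponent 𝒜 g r = r := by
  classical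
  have h := DirectSum.sum_support_decompose 𝒜 r
  have e : (∑ i : Additive G, (DirectSum.decompose 𝒜 r i : R)) = ∑ g : G, gradedComponent 𝒜 g r :=
    Fintype.sum_equiv Additive.toMul _ _ (fun _ => rfl)
  rw [← e]
  conv_rhs => rw [← h]
  symm
  refine Finset.sum_subset (Finset.subset_univ _) ?_
  intro i _ hi
  simpa using hi

theorem gradedComponent_mul (a b : R) (g h : G) (hb : b ∈ 𝒜 (Additive.ofMul h)) :
    gradedComponent 𝒜 g (a * b) = gradedComponent 𝒜 (g * h⁻¹) a * b := by
  have := DirectSum.coe_decompose_mul_add_of_right_mem 𝒜 (i := Additive.ofMul (g * h⁻¹))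
    (a := a) hb
  rw [← ofMul_mul, inv_mul_cancel_right] at this
  exact this

end Components

variable {R : Type u} {G : Type v} [Ring R] [Group G] [Fintype G] [DecidableEq G]
  (𝒜 : Additive G → AddSubgroup R) [GradedRing 𝒜]

/-- The biadditive extension of `(r p_g) (r' p_h) = r r'_{g h⁻¹} p_h`. -/
instance : Mul (SmashProduct 𝒜) where
  mul x y := ⟨fun h => ∑ g : G, x.coeff g * gradedComponent 𝒜 (g * h⁻¹) (y.coeff h)⟩

theorem coeff_mul (x y : SmashProduct 𝒜) (h : G) :
    (x * y).coeff h = ∑ g : G, x.coeff g * gradedComponent 𝒜 (g * h⁻¹) (y.coeff h) := rfl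

instance : Ring (SmashProduct 𝒜) :=
  { (inferInstance : AddCommGroup (SmashProduct 𝒜)),
    (inferInstance : Mul (SmashProduct 𝒜)),
    (inferInstance : One (SmashProduct 𝒜)) with
    left_distrib := fun x y z => by
      ext h; simp [coeff_mul, mul_add, Finset.sum_add_distrib]
    right_distrib := fun x y z => by
      ext h; simp [coeff_mul, add_mul, Finset.sum_add_distrib]
    zero_mul := fun x => by ext h; simp [coeff_mul]
    mul_zero := fun x => by ext h; simp [coeff_mul]
    one_mul := fun x => by
      ext h
      simp only [coeff_mul, coeff_one, one_mul]
      refine (Fintype.sum_equiv (Equiv.mulRight h⁻¹) _ (fun g => gradedComponent 𝒜 g (x.coeff h))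
        (fun _ => rfl)).trans (sum_gradedComponent 𝒜 _)
    mul_one := fun x => by
      ext h
      simp [coeff_mul, coeff_one, gradedComponent_one, mul_inv_eq_one]
    mul_assoc := fun x y z => by
      ext h
      simp only [coeff_mul, Finset.sum_mul, map_sum, Finset.mul_sum]
      rw [Finset.sum_comm]
      refine Finset.sum_congr rfl fun g _ => Finset.sum_congr rfl fun k _ => ?_
      rw [gradedComponent_mul 𝒜 _ _ _ _ (gradedComponent_mem 𝒜 (k * h⁻¹) (z.coeff h)), mul_assoc]
      congr 3
      group }

/-- The defining multiplication rule `(r p_g) (r' p_h) = r r'_{g h⁻¹} p_h`. -/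
theorem smul_p_mul_smul_p (r r' : R) (g h : G) :
    (r • p 𝒜 g) * (r' • p 𝒜 h) = (r * gradedComponent 𝒜 (g * h⁻¹) r') • p 𝒜 h := by
  ext k
  rw [coeff_mul]
  by_cases hk : k = h
  · subst hk; simp [p, Pi.single_apply]
  · simp [p, Pi.single_apply, hk]

end SmashProduct

/-! ### Flat modules over a noncommutative ring

Right `R`-modules are `Rᵐᵒᵖ`-modules: `n r` is `MulOpposite.op r • n`. -/

section Flat

open TensorProduct

variable (R : Type u) [Ring R]

/-- The relations `n r ⊗ m - n ⊗ r m` that cut `N ⊗_R M` out of `N ⊗_ℤ M`. -/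
def balancedRelations (N M : Type u) [AddCommGroup N] [Module Rᵐᵒᵖ N]
    [AddCommGroup M] [Module R M] : AddSubgroup (N ⊗[ℤ] M) :=
  AddSubgroup.closure
    {t | ∃ (n : N) (r : R) (m : M), t = (MulOpposite.op r • n) ⊗ₜ[ℤ] m - n ⊗ₜ[ℤ] (r • m)}

/-- The abelian group `N ⊗_R M` for a right `R`-module `N` and a left `R`-module `M`. -/
abbrev BalancedTensor (N M : Type u) [AddCommGroup N] [Module Rᵐᵒᵖ N]
    [AddCommGroup M] [Module R M] : Type u :=
  (N ⊗[ℤ] M) ⧸ balancedRelations R N M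

/-- The map `f ⊗ id : N ⊗_R M → N' ⊗_R M` induced by a map `f : N → N'` of right modules. -/
def BalancedTensor.map {N N' : Type u} (M : Type u) [AddCommGroup N] [Module Rᵐᵒᵖ N]
    [AddCommGroup N'] [Module Rᵐᵒᵖ N'] [AddCommGroup M] [Module R M] (f : N →ₗ[Rᵐᵒᵖ] N') :
    BalancedTensor R N M →+ BalancedTensor R N' M :=
  QuotientAddGroup.map _ _
    (LinearMap.rTensor M (f.toAddMonoidHom.toIntLinearMap)).toAddMonoidHom <| by
      rw [balancedRelations, AddSubgroup.closure_le]
      rintro _ ⟨n, r, m, rfl⟩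
      refine AddSubgroup.subset_closure ⟨f n, r, m, ?_⟩
      simp

/-- A left `R`-module `M` is flat if `- ⊗_R M` preserves injections of right `R`-modules. -/
def IsFlatModule (M : Type u) [AddCommGroup M] [Module R M] : Prop :=
  ∀ (N N' : Type u) [AddCommGroup N] [Module Rᵐᵒᵖ N] [AddCommGroup N'] [Module Rᵐᵒᵖ N']
    (f : N →ₗ[Rᵐᵒᵖ] N'), Function.Injective f → Function.Injective (BalancedTensor.map R M f)

end Flat

/-! ### Finiteness conditions on modules and rings -/

section RingClasses

open CategoryTheory

variable (R : Type u) [Ring R]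

/-- `M` is finitely `n`-presented: there is an exact sequence
`F n → ⋯ → F 1 → F 0 → M → 0` with `F 0, …, F n` finitely generated projective.
(The terms `F i` with `i > n` are irrelevant.) -/
def IsFinitelyPresentedOfOrder (n : ℕ) (M : Type u) [AddCommGroup M] [Module R M] : Prop :=
  ∃ (F : ℕ → ModuleCat.{u} R) (d : ∀ i, F (i + 1) →ₗ[R] F i) (ε : F 0 →ₗ[R] M),
    (∀ i ≤ n, Module.Finite R (F i) ∧ Module.Projective R (F i)) ∧
    Function.Surjective ε ∧
    (1 ≤ n → Function.Exact (d 0) ε) ∧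
    (∀ i, i + 2 ≤ n → Function.Exact (d (i + 1)) (d i))

/-- Left coherent: every finitely generated left ideal is finitely presented. -/
def IsLeftCoherentRing : Prop :=
  ∀ I : Ideal R, I.FG → Module.FinitePresentation R I

/-- Left `n`-coherent: every finitely `n`-presented module is finitely `(n+1)`-presented. -/
def IsLeftNCoherentRing (n : ℕ) : Prop :=
  ∀ M : ModuleCat.{u} R,
    IsFinitelyPresentedOfOrder R n M → IsFinitelyPresentedOfOrder R (n + 1) M

/-- Left `n`-perfect: every flat left module has projective dimension at most `n`. -/
def IsLeftNPerfectRing (n : ℕ) : Prop :=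
  ∀ M : ModuleCat.{u} R, IsFlatModule R M → HasProjectiveDimensionLE M n

/-- Left `(n,d)`-ring: every finitely `n`-presented module has projective dimension at most `d`. -/
def IsLeftNDRing (n d : ℕ) : Prop :=
  ∀ M : ModuleCat.{u} R, IsFinitelyPresentedOfOrder R n M → HasProjectiveDimensionLE M d

/-- Left regular: every finitely generated left ideal has finite projective dimension. -/
def IsLeftRegularRing : Prop :=
  ∀ I : Ideal R, I.FG → ∃ d : ℕ, HasProjectiveDimensionLE (ModuleCat.of R I) d

/-- Left regular coherent: left regular and left coherent. -/
def IsLeftRegularCoherentRing : Prop :=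
  IsLeftRegularRing R ∧ IsLeftCoherentRing R

/-- The `(n,0)`-injective dimension of `M` is `k`: `k` is the smallest natural number with
`Ext^{k+1}(F, M) = 0` for every finitely `n`-presented `F`. -/
def HasNInjectiveDimension (n : ℕ) (M : ModuleCat.{u} R) (k : ℕ) : Prop :=
  IsLeast {j : ℕ | ∀ F : ModuleCat.{u} R, IsFinitelyPresentedOfOrder R n F →
    Subsingleton (Abelian.Ext.{u} F M (j + 1))} k

/-- `n`-FC ring: left and right coherent, with `(1,0)`-injective dimension exactly `n` both as a
left and as a right module over itself. -/
def IsFCRing (n : ℕ) : Prop :=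
  IsLeftCoherentRing R ∧ IsLeftCoherentRing Rᵐᵒᵖ ∧
    HasNInjectiveDimension R 1 (ModuleCat.of R R) n ∧
    HasNInjectiveDimension Rᵐᵒᵖ 1 (ModuleCat.of Rᵐᵒᵖ R) n

/-- Ding-Chen ring: an `n`-FC ring for some `n ≥ 0`. -/
def IsDingChenRing : Prop := ∃ n : ℕ, IsFCRing R n

end RingClasses

open CategoryTheory

/-! Write S for the smash product. It contains R through r ↦ ∑ r p_g, is free over R on both sides
with basis the orthogonal idempotents p_g, and satisfies p_g r p_h = r_{gh⁻¹} p_h = p_g r_{gh⁻¹}.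
`SmashExtension` records just these facts. They are left-right symmetric, so every result also
applies to the opposite rings.

Two consequences carry the proof. Restriction to R is exact, keeps projective, flat and finitely
n-presented modules, and both detects and preserves finite generation. Its left adjoint, induction S
⊗_R N, lives on the group of families ι → N, so it is exact too. Moreover, averaging f into ∑ p_i f
p_i turns R-linear maps into S-linear ones without any division, because ∑ p_i p_i = 1. Hence each
S-module M is a summand of the module induced from its restriction (`retractIndRes`), and its
projective dimension over S is at most the one over R.

This gives the n-perfect, (n,d) and regular parts. Averaging a projection onto a left ideal gives
semisimplicity, as in Maschke's theorem. Coherence ascends because left ideals of S embed in finite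
free R-modules, and descends by inducing left ideals of R. For Ding-Chen rings the adjunction
compares Ext over S into S with Ext over R into the restriction of S, a finite power of R. -/

/-- A ring extension `φ : R → S` which is free on both sides over `R` on a complete finite family of
orthogonal idempotents `p i`, together with a matrix of components `c i j : R → R` describing how
the idempotents commute with `R`. -/
structure SmashExtension (R S ι : Type u) [Ring R] [Ring S] [Fintype ι] [DecidableEq ι] where
  /-- The structure map. -/
  φ : R →+* S
  /-- The idempotents. -/
  p : ι → S
  /-- The components of elements of `R`. -/
  c : ι → ι → R → R
  p_mul_p : ∀ i j, p i * p j = if i = j then p i else 0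
  sum_p : ∑ i, p i = 1
  left_bijective : Function.Bijective fun x : ι → R => ∑ i, φ (x i) * p i
  right_bijective : Function.Bijective fun x : ι → R => ∑ i, p i * φ (x i)
  p_mul_mul_p : ∀ i j r, p i * φ r * p j = φ (c i j r) * p j
  p_mul_c : ∀ i j r, p i * φ (c i j r) = φ (c i j r) * p j

/-! ### Coefficient calculus, duality and averaging. -/

namespace SmashExtension

variable {R S ι : Type u} [Ring R] [Ring S] [Fintype ι] [DecidableEq ι] (D : SmashExtension R S ι)

/-- The opposite extension. -/
def op : SmashExtension Rᵐᵒᵖ Sᵐᵒᵖ ι where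
  φ := D.φ.op
  p i := MulOpposite.op (D.p i)
  c i j r := MulOpposite.op (D.c j i r.unop)
  p_mul_p i j := by
    rw [← MulOpposite.op_mul, D.p_mul_p]
    by_cases h : i = j
    · subst h; simp
    · simp [h, Ne.symm h]
  sum_p := by
    apply MulOpposite.unop_injective
    simp [D.sum_p]
  left_bijective := by
    have e : (fun x : ι → Rᵐᵒᵖ => ∑ i, D.φ.op (x i) * MulOpposite.op (D.p i)) =
        MulOpposite.opEquiv ∘ (fun x : ι → R => ∑ i, D.p i * D.φ (x i)) ∘
          (fun x i => (x i).unop) := by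
      ext x; simp
    rw [e]
    exact MulOpposite.opEquiv.bijective.comp (D.right_bijective.comp
      (Equiv.piCongrRight fun _ => MulOpposite.opEquiv.symm).bijective)
  right_bijective := by
    have e : (fun x : ι → Rᵐᵒᵖ => ∑ i, MulOpposite.op (D.p i) * D.φ.op (x i)) =
        MulOpposite.opEquiv ∘ (fun x : ι → R => ∑ i, D.φ (x i) * D.p i) ∘
          (fun x i => (x i).unop) := by
      ext x; simp
    rw [e]
    exact MulOpposite.opEquiv.bijective.comp (D.left_bijective.comp
      (Equiv.piCongrRight fun _ => MulOpposite.opEquiv.symm).bijective)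
  -- Reversing products puts the component on the wrong side of the idempotent; `p_mul_c` moves it
  -- back, and so makes the axioms self-dual.
  p_mul_mul_p i j r := by
    apply MulOpposite.unop_injective
    simp [← mul_assoc, D.p_mul_mul_p, D.p_mul_c]
  p_mul_c i j r := by
    apply MulOpposite.unop_injective
    simp [D.p_mul_c]

/-- Uniqueness of coefficients in one coordinate. It lets identities between components be checked
in S after multiplying by an idempotent. -/
theorem φ_mul_p_injective (i : ι) : Function.Injective fun r => D.φ r * D.p i := by
  intro a b h
  have := @D.left_bijective.1 (Pi.single i a) (Pi.single i b) (by
    simp only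
    rw [Finset.sum_eq_single i, Finset.sum_eq_single i]
    · simpa using h
    all_goals simp +contextual)
  simpa using congrFun this i

theorem c_add (i j : ι) (x y : R) : D.c i j (x + y) = D.c i j x + D.c i j y := by
  apply D.φ_mul_p_injective j
  simp only [map_add, add_mul, ← D.p_mul_mul_p, mul_add]

theorem c_zero (i j : ι) : D.c i j 0 = 0 := by
  apply D.φ_mul_p_injective j
  simp only [← D.p_mul_mul_p, map_zero, mul_zero, zero_mul]

/-- The component maps as additive homomorphisms. -/
def cHom (i j : ι) : R →+ R where
  toFun := D.c i j
  map_zero' := D.c_zero i j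
  map_add' := D.c_add i j

theorem c_sum {κ : Type*} (t : Finset κ) (i j : ι) (f : κ → R) :
    D.c i j (∑ k ∈ t, f k) = ∑ k ∈ t, D.c i j (f k) :=
  map_sum (D.cHom i j) f t

theorem c_one (i j : ι) : D.c i j 1 = if i = j then 1 else 0 := by
  apply D.φ_mul_p_injective j
  simp only [← D.p_mul_mul_p, map_one, mul_one, D.p_mul_p]
  split_ifs with h
  · simp [h]
  · simp

/-- For graded rings this is (x b)_g = x_{gh⁻¹} b with b homogeneous of degree h. Since c j k y
trades p k for p j, both sides come from p i x p j y p k. It is the associativity behind the induced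
module. -/
theorem c_mul (i j k : ι) (x y : R) :
    D.c i k (x * D.c j k y) = D.c i j x * D.c j k y := by
  apply D.φ_mul_p_injective k
  simp only [← D.p_mul_mul_p, map_mul]
  rw [mul_assoc, mul_assoc, ← D.p_mul_c, ← mul_assoc, ← mul_assoc, D.p_mul_mul_p, mul_assoc,
    D.p_mul_c, mul_assoc]

theorem sum_c_left (j : ι) (r : R) : ∑ i, D.c i j r = r := by
  apply D.φ_mul_p_injective j
  simp only [map_sum, Finset.sum_mul, ← D.p_mul_mul_p]
  rw [← Finset.sum_mul, ← Finset.sum_mul, D.sum_p, one_mul]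

/-- The opposite extension swaps the two indices, so this is `sum_c_left` there. -/
theorem sum_c_right (i : ι) (r : R) : ∑ j, D.c i j r = r := by
  have := D.op.sum_c_left i (MulOpposite.op r)
  have := congrArg MulOpposite.unop this
  simpa [op] using this

/-- The coefficients of an element of `S` in the left basis `p`. -/
noncomputable def coeff (s : S) : ι → R := (Equiv.ofBijective _ D.left_bijective).symm s

theorem sum_coeff (s : S) : ∑ i, D.φ (D.coeff s i) * D.p i = s :=
  (Equiv.ofBijective _ D.left_bijective).apply_symm_apply s

theorem coeff_mul_p (s : S) (i : ι) : D.φ (D.coeff s i) * D.p i = s * D.p i := by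
  conv_rhs => rw [← D.sum_coeff s, Finset.sum_mul]
  simp [mul_assoc, D.p_mul_p]

theorem coeff_eq {s : S} {i : ι} {r : R} (h : s * D.p i = D.φ r * D.p i) : D.coeff s i = r :=
  D.φ_mul_p_injective i ((D.coeff_mul_p s i).trans h)

theorem coeff_φ (r : R) (i : ι) : D.coeff (D.φ r) i = r := D.coeff_eq rfl

theorem coeff_p (i j : ι) : D.coeff (D.p i) j = if i = j then 1 else 0 := by
  apply D.coeff_eq
  rw [D.p_mul_p]
  split_ifs with h <;> simp [h]

theorem coeff_add (s t : S) (i : ι) : D.coeff (s + t) i = D.coeff s i + D.coeff t i := by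
  apply D.coeff_eq
  simp [add_mul, D.coeff_mul_p]

theorem coeff_mul (s t : S) (k : ι) :
    D.coeff (s * t) k = ∑ j, D.coeff s j * D.c j k (D.coeff t k) := by
  apply D.coeff_eq
  rw [mul_assoc, ← D.coeff_mul_p t k, ← mul_assoc]
  conv_lhs => rw [← D.sum_coeff s]
  simp only [Finset.sum_mul, map_sum, map_mul, mul_assoc]
  refine Finset.sum_congr rfl fun j _ => ?_
  rw [← mul_assoc (D.p j), D.p_mul_mul_p]

/-- `S` is free as a left module over `R`. -/
noncomputable def coeffEquiv [Module R S] (h : ∀ (r : R) (s : S), D.φ r * s = r • s) :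
    S ≃ₗ[R] (ι → R) :=
  LinearEquiv.symm
    { Equiv.ofBijective _ D.left_bijective with
      map_add' := fun x y => by simp [add_mul, Finset.sum_add_distrib]
      map_smul' := fun r x => by simp [mul_assoc, ← h, Finset.mul_sum] }

/-- The averaging of an additive map over the idempotents. -/
def average {M N : Type*} [AddCommGroup M] [Module R M] [Module S M] [AddCommGroup N]
    [Module R N] [Module S N] (hM : ∀ (r : R) (m : M), D.φ r • m = r • m)
    (hN : ∀ (r : R) (n : N), D.φ r • n = r • n) (f : M →ₗ[R] N) : M →ₗ[S] N where
  toFun m := ∑ i, D.p i • f (D.p i • m)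
  map_add' x y := by simp [Finset.sum_add_distrib]
  map_smul' s m := by
    simp only [RingHom.id_apply]
    -- The elements φ r p k span S additively, so linearity is needed only for them. Inside f such
    -- an element becomes c i k r acting on p k m, which the R-linear f releases.
    have key : ∀ (r : R) (k : ι), ∑ i, D.p i • f (D.p i • (D.φ r * D.p k) • m) =
        (D.φ r * D.p k) • ∑ i, D.p i • f (D.p i • m) := by
      intro r k
      have h1 : ∀ i, D.p i • f (D.p i • (D.φ r * D.p k) • m) =
          (D.p i * D.φ r * D.p k) • f (D.p k • m) := by
        intro i
        have : D.p i • (D.φ r * D.p k) • m = D.c i k r • D.p k • m := by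
          rw [← mul_smul, ← mul_assoc, D.p_mul_mul_p, mul_smul, hM]
        rw [this, map_smul, ← hN, ← mul_smul, D.p_mul_c, D.p_mul_mul_p]
      simp only [h1]
      rw [← Finset.sum_smul, ← Finset.sum_mul, ← Finset.sum_mul, D.sum_p, one_mul,
        Finset.smul_sum, Finset.sum_eq_single k]
      · rw [← mul_smul, mul_assoc, D.p_mul_p, if_pos rfl]
      · intro j _ hj
        rw [← mul_smul, mul_assoc, D.p_mul_p, if_neg hj.symm, mul_zero, zero_smul]
      · simp
    have hs : s • m = ∑ k, (D.φ (D.coeff s k) * D.p k) • m := by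
      rw [← Finset.sum_smul, D.sum_coeff]
    rw [hs]
    conv_rhs => rw [← D.sum_coeff s, Finset.sum_smul]
    simp only [← key, map_sum, Finset.smul_sum (r := D.p _)]
    rw [Finset.sum_comm]

/-! ### Induced modules. -/

/-- The `S`-module induced from an `R`-module `N`; its underlying group is `ι → N`. -/
@[nolint unusedArguments]
def Ind (_ : SmashExtension R S ι) (N : Type u) : Type u := ι → N

section Ind

variable (N : Type u) [AddCommGroup N]

instance : AddCommGroup (D.Ind N) := inferInstanceAs (AddCommGroup (ι → N))

variable {N} in
/-- The constant family with value `n`. -/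
def Ind.const (n : N) : D.Ind N := fun _ => n

variable [Module R N]

/-- A family n stands for ∑ p i ⊗ n i in S ⊗_R N. If s has coefficients x, then s p i = φ (x i) p i
= ∑ j, p j φ (c j i (x i)), which dictates the formula. -/
noncomputable instance : Module S (D.Ind N) where
  smul s n := fun j => ∑ i, D.c j i (D.coeff s i) • n i
  one_smul n := by
    funext j
    change ∑ i, D.c j i (D.coeff 1 i) • n i = n j
    have : ∀ i, D.coeff 1 i = 1 := fun i => by simpa using D.coeff_φ 1 i
    simp only [this, D.c_one, ite_smul, one_smul, zero_smul]
    exact (Finset.sum_ite_eq Finset.univ j n).trans (if_pos (Finset.mem_univ j))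
  mul_smul s t n := by
    funext j
    change ∑ k, D.c j k (D.coeff (s * t) k) • n k =
      ∑ i, D.c j i (D.coeff s i) • ∑ k, D.c i k (D.coeff t k) • n k
    simp only [D.coeff_mul, D.c_sum, D.c_mul, Finset.sum_smul, Finset.smul_sum, mul_smul]
    rw [Finset.sum_comm]
  smul_zero s := by
    funext j
    change ∑ i, D.c j i (D.coeff s i) • (0 : N) = 0
    simp
  smul_add s x y := by
    funext j
    change ∑ i, D.c j i (D.coeff s i) • (x i + y i) =
      ∑ i, D.c j i (D.coeff s i) • x i + ∑ i, D.c j i (D.coeff s i) • y i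
    simp [Finset.sum_add_distrib]
  add_smul s t x := by
    funext j
    change ∑ i, D.c j i (D.coeff (s + t) i) • x i =
      ∑ i, D.c j i (D.coeff s i) • x i + ∑ i, D.c j i (D.coeff t i) • x i
    simp [D.coeff_add, D.c_add, add_smul, Finset.sum_add_distrib]
  zero_smul x := by
    funext j
    change ∑ i, D.c j i (D.coeff 0 i) • x i = 0
    have : ∀ i, D.coeff 0 i = 0 := fun i => by simpa using D.coeff_φ 0 i
    simp [this, D.c_zero]

variable {N}

theorem Ind.smul_apply (s : S) (n : D.Ind N) (j : ι) :
    (s • n) j = ∑ i, D.c j i (D.coeff s i) • n i := rfl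

theorem Ind.φ_smul_apply (r : R) (n : D.Ind N) (j : ι) :
    (D.φ r • n) j = ∑ i, D.c j i r • n i := by
  simp [Ind.smul_apply, D.coeff_φ]

theorem Ind.p_smul_apply (i : ι) (n : D.Ind N) (j : ι) :
    (D.p i • n) j = if i = j then n i else 0 := by
  rw [Ind.smul_apply, Finset.sum_eq_single i]
  · rw [D.coeff_p, if_pos rfl, D.c_one]
    by_cases h : i = j
    · simp [h]
    · simp [h, Ne.symm h]
  · intro k _ hk
    rw [D.coeff_p, if_neg hk.symm, D.c_zero, zero_smul]
  · simp

/-- The constant family is 1 ⊗ n, since ∑ p i = 1; this is the linearity of the unit of the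
adjunction. -/
theorem Ind.const_smul (r : R) (n : N) : Ind.const D (r • n) = D.φ r • Ind.const D n := by
  funext j
  rw [Ind.φ_smul_apply]
  simp only [Ind.const]
  rw [← Finset.sum_smul, D.sum_c_right]

theorem Ind.sum_p_smul_const (n : D.Ind N) : ∑ i, D.p i • Ind.const D (n i) = n := by
  funext j
  rw [show (∑ i, D.p i • Ind.const D (n i)) j = ∑ i, (D.p i • Ind.const D (n i)) j from
    Finset.sum_apply j _ _]
  simp only [Ind.p_smul_apply, Ind.const]
  exact (Finset.sum_ite_eq' Finset.univ j n).trans (if_pos (Finset.mem_univ j))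

/-- The `S`-linear map out of an induced module determined by an `R`-linear map. -/
noncomputable def Ind.lift {M : Type*} [AddCommGroup M] [Module R M] [Module S M]
    (hM : ∀ (r : R) (m : M), D.φ r • m = r • m) (f : N →ₗ[R] M) : D.Ind N →ₗ[S] M where
  toFun n := ∑ i, D.p i • f (n i)
  map_add' x y := by
    change ∑ i, D.p i • f (x i + y i) = _
    simp [Finset.sum_add_distrib]
  map_smul' s n := by
    simp only [RingHom.id_apply, Ind.smul_apply, map_sum, map_smul, Finset.smul_sum, ← hM,
      ← mul_smul, D.p_mul_c]
    rw [Finset.sum_comm]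
    refine Finset.sum_congr rfl fun k _ => ?_
    simp only [← D.p_mul_mul_p]
    rw [← Finset.sum_smul, ← Finset.sum_mul, ← Finset.sum_mul, D.sum_p, one_mul, D.coeff_mul_p]

theorem Ind.lift_apply {M : Type*} [AddCommGroup M] [Module R M] [Module S M]
    (hM : ∀ (r : R) (m : M), D.φ r • m = r • m) (f : N →ₗ[R] M) (n : D.Ind N) :
    Ind.lift D hM f n = ∑ i, D.p i • f (n i) := rfl

theorem Ind.lift_const {M : Type*} [AddCommGroup M] [Module R M] [Module S M]
    (hM : ∀ (r : R) (m : M), D.φ r • m = r • m) (f : N →ₗ[R] M) (n : N) :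
    Ind.lift D hM f (Ind.const D n) = f n := by
  rw [Ind.lift_apply]
  simp only [Ind.const]
  rw [← Finset.sum_smul, D.sum_p, one_smul]

/-- The map induced by a linear map. -/
noncomputable def Ind.map {N' : Type u} [AddCommGroup N'] [Module R N'] (f : N →ₗ[R] N') :
    D.Ind N →ₗ[S] D.Ind N' where
  toFun n := fun i => f (n i)
  map_add' x y := by
    funext i
    exact map_add f (x i) (y i)
  map_smul' s n := by
    funext i
    exact (map_sum f _ _).trans (Finset.sum_congr rfl fun k _ => map_smul f _ _)

end Ind

end SmashExtension

/-! ### Finitely n-presented modules and Schanuel's lemma. -/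

section FinitelyPresentedOfOrder

variable {R : Type u} [Ring R] {M N P Q : Type u} [AddCommGroup M] [Module R M]
  [AddCommGroup N] [Module R N] [AddCommGroup P] [Module R P] [AddCommGroup Q] [Module R Q]

theorem isFinitelyPresentedOfOrder_zero_iff :
    IsFinitelyPresentedOfOrder R 0 M ↔ Module.Finite R M := by
  constructor
  · rintro ⟨F, d, ε, hF, hε, -⟩
    have := (hF 0 le_rfl).1
    exact Module.Finite.of_surjective ε hε
  · intro h
    obtain ⟨n, f, hf⟩ := Module.Finite.exists_fin' R M
    refine ⟨fun _ => ModuleCat.of R (Fin n → R), fun _ => 0, f, fun i _ => ?_, hf, by simp, by simp⟩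
    exact ⟨inferInstanceAs (Module.Finite R (Fin n → R)),
      inferInstanceAs (Module.Projective R (Fin n → R))⟩

theorem isFinitelyPresentedOfOrder_succ_of_surjective {n : ℕ} [Module.Finite R P]
    [Module.Projective R P] (g : P →ₗ[R] M) (hg : Function.Surjective g)
    (h : IsFinitelyPresentedOfOrder R n (LinearMap.ker g)) :
    IsFinitelyPresentedOfOrder R (n + 1) M := by
  obtain ⟨F, d, ε, hF, hε, h0, h1⟩ := h
  refine ⟨fun i => Nat.casesOn i (ModuleCat.of R P) F,
    fun i => match i with
      | 0 => (LinearMap.ker g).subtype ∘ₗ ε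
      | i + 1 => d i, g, ?_, hg, ?_, ?_⟩
  · rintro (_ | i) hi
    · exact ⟨‹_›, ‹_›⟩
    · exact hF i (by lia)
  · intro _ x
    constructor
    · intro hx
      obtain ⟨y, hy⟩ := hε ⟨x, hx⟩
      exact ⟨y, congrArg Subtype.val hy⟩
    · rintro ⟨y, rfl⟩
      exact (ε y).2
  · rintro (_ | i) hi
    · intro x
      refine Iff.trans ?_ (h0 (by lia) x)
      exact Submodule.coe_eq_zero
    · exact h1 i (by lia)

theorem IsFinitelyPresentedOfOrder.exists_surjective {n : ℕ}
    (h : IsFinitelyPresentedOfOrder R (n + 1) M) :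
    ∃ (P : ModuleCat.{u} R) (g : P →ₗ[R] M), Module.Finite R P ∧ Module.Projective R P ∧
      Function.Surjective g ∧ IsFinitelyPresentedOfOrder R n (LinearMap.ker g) := by
  obtain ⟨F, d, ε, hF, hε, h0, h1⟩ := h
  have h0 := h0 (by lia)
  refine ⟨F 0, ε, (hF 0 (by lia)).1, (hF 0 (by lia)).2, hε, fun i => F (i + 1),
    fun i => d (i + 1), (d 0).codRestrict _ fun x => (h0 _).2 ⟨x, rfl⟩,
    fun i hi => hF (i + 1) (by lia), ?_, ?_, fun i hi => h1 (i + 1) (by lia)⟩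
  · rintro ⟨x, hx⟩
    obtain ⟨y, hy⟩ := (h0 x).1 hx
    exact ⟨y, Subtype.ext hy⟩
  · intro hn x
    refine Iff.trans ?_ (h1 0 (by lia) x)
    exact Submodule.coe_eq_zero.symm

theorem IsFinitelyPresentedOfOrder.finite {n : ℕ} (h : IsFinitelyPresentedOfOrder R n M) :
    Module.Finite R M := by
  obtain ⟨F, d, ε, hF, hε, -⟩ := h
  have := (hF 0 (by lia)).1
  exact Module.Finite.of_surjective ε hε

theorem IsFinitelyPresentedOfOrder.of_linearEquiv {n : ℕ} (h : IsFinitelyPresentedOfOrder R n M)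
    (e : M ≃ₗ[R] N) : IsFinitelyPresentedOfOrder R n N := by
  obtain ⟨F, d, ε, hF, hε, h0, h1⟩ := h
  refine ⟨F, d, e.toLinearMap ∘ₗ ε, hF, e.surjective.comp hε, fun hn x => ?_, h1⟩
  refine Iff.trans ?_ (h0 hn x)
  simp

theorem isFinitelyPresentedOfOrder_of_projective (n : ℕ) [Module.Finite R P]
    [Module.Projective R P] : IsFinitelyPresentedOfOrder R n P := by
  induction n generalizing P with
  | zero => exact isFinitelyPresentedOfOrder_zero_iff.2 ‹_›
  | succ n ih =>
    refine isFinitelyPresentedOfOrder_succ_of_surjective (LinearMap.id : P →ₗ[R] P)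
      Function.surjective_id ?_
    have : Subsingleton (LinearMap.ker (LinearMap.id : P →ₗ[R] P)) := by
      rw [LinearMap.ker_id]; infer_instance
    have : Module.Projective R (LinearMap.ker (LinearMap.id : P →ₗ[R] P)) :=
      Module.Projective.of_free
    exact ih

/-- The kernel of a product of linear maps. -/
def LinearMap.kerProdMapEquiv (f : P →ₗ[R] M) (g : Q →ₗ[R] N) :
    (LinearMap.ker f × LinearMap.ker g) ≃ₗ[R] LinearMap.ker (f.prodMap g) where
  toFun x := ⟨(x.1.1, x.2.1), by simp⟩
  invFun x := (⟨x.1.1, congrArg Prod.fst x.2⟩, ⟨x.1.2, congrArg Prod.snd x.2⟩)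
  map_add' _ _ := rfl
  map_smul' _ _ := rfl
  left_inv _ := rfl
  right_inv _ := rfl

theorem IsFinitelyPresentedOfOrder.prod {n : ℕ} (hM : IsFinitelyPresentedOfOrder R n M)
    (hN : IsFinitelyPresentedOfOrder R n N) : IsFinitelyPresentedOfOrder R n (M × N) := by
  induction n generalizing M N with
  | zero =>
    have := hM.finite
    have := hN.finite
    exact isFinitelyPresentedOfOrder_zero_iff.2 inferInstance
  | succ n ih =>
    obtain ⟨P, f, _, _, hf, hf'⟩ := hM.exists_surjective
    obtain ⟨Q, g, _, _, hg, hg'⟩ := hN.exists_surjective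
    exact isFinitelyPresentedOfOrder_succ_of_surjective (f.prodMap g) (hf.prodMap hg)
      ((ih hf' hg').of_linearEquiv (LinearMap.kerProdMapEquiv f g))

/-- A retract form of Schanuel's lemma. -/
theorem LinearMap.exists_retract_ker [Module.Projective R P] [Module.Projective R Q]
    (f : P →ₗ[R] M) (hf : Function.Surjective f) (g : Q →ₗ[R] M) (hg : Function.Surjective g) :
    ∃ (i : ker g →ₗ[R] ker f × Q) (r : ker f × Q →ₗ[R] ker g), ∀ x, r (i x) = x := by
  obtain ⟨a, ha⟩ := Module.projective_lifting_property g f hg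
  obtain ⟨b, hb⟩ := Module.projective_lifting_property f g hf
  have ha' : ∀ x, g (a x) = f x := fun x => LinearMap.congr_fun ha x
  have hb' : ∀ x, f (b x) = g x := fun x => LinearMap.congr_fun hb x
  -- The lift b carries ker g into ker f, a carries ker f into ker g, and id - a b has values in ker
  -- g. The two a b terms cancel in the composite.
  refine ⟨((b ∘ₗ (ker g).subtype).codRestrict (ker f) fun x => ?_).prod (ker g).subtype,
    ((a ∘ₗ (ker f).subtype).coprod (LinearMap.id - a ∘ₗ b)).codRestrict (ker g) fun x => ?_,
    fun x => ?_⟩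
  · simp [hb']
  · simp [ha', hb']
  · apply Subtype.ext
    change a (b x) + ((x : Q) - a (b x)) = x
    abel

theorem IsFinitelyPresentedOfOrder.of_retract {n : ℕ} (hN : IsFinitelyPresentedOfOrder R n N)
    (i : M →ₗ[R] N) (r : N →ₗ[R] M) (h : ∀ x, r (i x) = x) :
    IsFinitelyPresentedOfOrder R n M := by
  induction n generalizing M N with
  | zero =>
    have := hN.finite
    exact isFinitelyPresentedOfOrder_zero_iff.2
      (Module.Finite.of_surjective r fun x => ⟨i x, h x⟩)
  | succ n ih =>
    obtain ⟨P, g, _, _, hg, hg'⟩ := hN.exists_surjective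
    refine isFinitelyPresentedOfOrder_succ_of_surjective (r ∘ₗ g)
      ((Function.LeftInverse.surjective h).comp hg) ?_
    -- This map respects the splitting of N by the idempotent i r, so ker (r g) is a summand of its
    -- kernel. That kernel is a retract of ker g × (P × P) by Schanuel, so the induction hypothesis
    -- is used twice.
    let g' : P × P →ₗ[R] N := (i ∘ₗ r ∘ₗ g).coprod (g - i ∘ₗ r ∘ₗ g)
    have hg'' : Function.Surjective g' := fun x => by
      obtain ⟨y, rfl⟩ := hg x
      exact ⟨(y, y), by simp [g']⟩
    obtain ⟨j, s, hjs⟩ := LinearMap.exists_retract_ker g hg g' hg''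
    have key := ih (hg'.prod (isFinitelyPresentedOfOrder_of_projective n)) j s hjs
    have hk : ∀ x : LinearMap.ker g', (r ∘ₗ g) x.1.1 = 0 := fun x => by
      have hx : i (r (g x.1.1)) + (g x.1.2 - i (r (g x.1.2))) = 0 := x.2
      simpa [h] using congrArg r hx
    refine ih key
      ((LinearMap.inl R P P ∘ₗ (LinearMap.ker (r ∘ₗ g)).subtype).codRestrict _ fun x => ?_)
      ((LinearMap.fst R P P ∘ₗ (LinearMap.ker g').subtype).codRestrict _ hk) fun x => ?_
    · have : r (g x.1) = 0 := x.2
      simp [g', this]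
    · rfl

/-- The definition supplies one good first syzygy; Schanuel and closure under retracts make every
choice good. -/
theorem IsFinitelyPresentedOfOrder.ker {n : ℕ} (hM : IsFinitelyPresentedOfOrder R (n + 1) M)
    [Module.Finite R P] [Module.Projective R P] (g : P →ₗ[R] M) (hg : Function.Surjective g) :
    IsFinitelyPresentedOfOrder R n (LinearMap.ker g) := by
  obtain ⟨Q, f, _, _, hf, hf'⟩ := hM.exists_surjective
  obtain ⟨j, s, hjs⟩ := LinearMap.exists_retract_ker f hf g hg
  exact (hf'.prod (isFinitelyPresentedOfOrder_of_projective n)).of_retract j s hjs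

end FinitelyPresentedOfOrder

/-! ### Finitely generated submodules of finite free modules. -/

section Submodules

variable {R : Type u} [Ring R]

/-- A class of finitely presented modules closed under extensions and containing the finitely
generated left ideals contains the finitely generated submodules of finite free modules. -/
theorem ModuleCat.prop_of_injective_pi (C : ModuleCat.{u} R → Prop)
    (hfp : ∀ X, C X → Module.FinitePresentation R X)
    (hequiv : ∀ X Y : ModuleCat.{u} R, (X ≃ₗ[R] Y) → C X → C Y)
    (hext : ∀ (X Y : ModuleCat.{u} R) (f : X →ₗ[R] Y), Function.Surjective f → C Y →
      C (.of R (LinearMap.ker f)) → C X)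
    (hI : ∀ I : Ideal R, I.FG → C (.of R I)) {ι : Type*} [Finite ι]
    (X : ModuleCat.{u} R) [Module.Finite R X] (f : X →ₗ[R] (ι → R))
    (hf : Function.Injective f) : C X := by
  suffices H : ∀ (n : ℕ) (X : ModuleCat.{u} R) [Module.Finite R X] (f : X →ₗ[R] (Fin n → R)),
      Function.Injective f → C X by
    obtain ⟨n, ⟨e⟩⟩ := Finite.exists_equiv_fin ι
    refine H n X ((LinearEquiv.funCongrLeft R R e.symm).toLinearMap ∘ₗ f) ?_
    exact (LinearEquiv.funCongrLeft R R e.symm).injective.comp hf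
  intro n
  induction n with
  | zero =>
    intro X _ f hf
    have : Subsingleton X := hf.subsingleton
    exact hequiv (.of R (⊥ : Ideal R)) X
      { toFun := 0, invFun := 0, map_add' := by simp, map_smul' := by simp,
        left_inv := fun _ => Subsingleton.elim _ _, right_inv := fun _ => Subsingleton.elim _ _ }
      (hI ⊥ Submodule.fg_bot)
  | succ n ih =>
    intro X _ f hf
    -- The image of the first coordinate is a finitely generated left ideal. Being finitely
    -- presented, it forces a finitely generated kernel, which embeds in the remaining coordinates.
    let g : X →ₗ[R] R := LinearMap.proj 0 ∘ₗ f
    have hg : C (.of R (LinearMap.range g)) := hI _ (Submodule.FG.of_finite)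
    have hsurj := g.surjective_rangeRestrict
    have := hfp _ hg
    have hker : (LinearMap.ker g.rangeRestrict).FG :=
      Module.FinitePresentation.fg_ker (N := LinearMap.range g) _ hsurj
    refine hext X (.of R (LinearMap.range g)) g.rangeRestrict hsurj hg ?_
    have : Module.Finite R (ModuleCat.of R (LinearMap.ker g.rangeRestrict)) :=
      Module.Finite.iff_fg.2 hker
    refine ih (.of R (LinearMap.ker g.rangeRestrict))
      (LinearMap.funLeft R R Fin.succ ∘ₗ f ∘ₗ Submodule.subtype _) ?_
    intro x y hxy
    apply Subtype.ext
    apply hf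
    funext i
    refine Fin.cases ?_ (fun i => congrFun hxy i) i
    have hx : g x.1 = 0 := congrArg Subtype.val x.2
    have hy : g y.1 = 0 := congrArg Subtype.val y.2
    exact hx.trans hy.symm

theorem IsLeftCoherentRing.finitePresentation (hR : IsLeftCoherentRing R) {ι : Type*} [Finite ι]
    {X : Type u} [AddCommGroup X] [Module R X] [Module.Finite R X] (f : X →ₗ[R] (ι → R))
    (hf : Function.Injective f) : Module.FinitePresentation R X :=
  ModuleCat.prop_of_injective_pi (fun X => Module.FinitePresentation R X) (fun _ h => h)
    (fun _ _ e _ => .of_equiv e)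
    (fun _ _ f hf _ _ => Module.finitePresentation_of_ker f hf) hR (.of R X) f hf

/-- Finite presentation is carried along with finite projective dimension because the dévissage
needs finitely generated kernels. -/
theorem IsLeftRegularCoherentRing.exists_projectiveDimension (hR : IsLeftRegularCoherentRing R)
    {ι : Type*} [Finite ι] (X : ModuleCat.{u} R) [Module.Finite R X] (f : X →ₗ[R] (ι → R))
    (hf : Function.Injective f) : ∃ d : ℕ, HasProjectiveDimensionLE X d := by
  refine (ModuleCat.prop_of_injective_pi (fun X => Module.FinitePresentation R X ∧
    ∃ d : ℕ, HasProjectiveDimensionLE X d) (fun _ h => h.1) ?_ ?_ ?_ X f hf).2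
  · rintro X Y e ⟨h, d, hd⟩
    exact ⟨.of_equiv e, d, hasProjectiveDimensionLT_of_iso e.toModuleIso _⟩
  · rintro X Y f hf ⟨hY, d, hd⟩ ⟨hK, d', hd'⟩
    refine ⟨Module.finitePresentation_of_ker f hf, max d d', ?_⟩
    refine (LinearMap.shortExact_shortComplexKer hf).hasProjectiveDimensionLT_X₂ _ ?_ ?_
    · exact hasProjectiveDimensionLT_of_ge _ (d' + 1) _ (by lia)
    · exact hasProjectiveDimensionLT_of_ge _ (d + 1) _ (by lia)
  · exact fun I hI => ⟨hR.2 I hI, hR.1 I hI⟩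

end Submodules

/-! ### Ext vanishing, retracts and dimension shifting. -/

namespace CategoryTheory

open Abelian Limits

variable {C : Type u} [Category.{v} C] [Abelian C] [HasExt.{v} C]

/-- Since Ext¹ vanishes on the projective middle term, Ext¹ of the quotient is the cokernel of
restricting maps along the inclusion. -/
theorem ShortComplex.ShortExact.subsingleton_ext_one_iff {S : ShortComplex C} (hS : S.ShortExact)
    [Projective S.X₂] (M : C) :
    Subsingleton (Ext.{v} S.X₃ M 1) ↔ ∀ f : S.X₁ ⟶ M, ∃ g : S.X₂ ⟶ M, S.f ≫ g = f := by
  constructor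
  · intro h f
    obtain ⟨x, hx⟩ := Ext.contravariant_sequence_exact₁ hS M (Ext.mk₀ f) (n₁ := 1) rfl
      (Subsingleton.elim _ _)
    obtain ⟨g, rfl⟩ := (Ext.mk₀_bijective _ _).2 x
    exact ⟨g, (Ext.mk₀_bijective _ _).1 (by rw [← hx, Ext.mk₀_comp_mk₀])⟩
  · intro h
    refine subsingleton_of_forall_eq 0 fun x => ?_
    obtain ⟨y, rfl⟩ := Ext.contravariant_sequence_exact₃ hS M x
      (Ext.eq_zero_of_projective _) (n₀ := 0) rfl
    obtain ⟨f, rfl⟩ := (Ext.mk₀_bijective _ _).2 y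
    obtain ⟨g, rfl⟩ := h f
    rw [← Ext.mk₀_comp_mk₀, ShortComplex.ShortExact.extClass_comp_assoc]

theorem ShortComplex.ShortExact.subsingleton_ext_succ_iff {S : ShortComplex C} (hS : S.ShortExact)
    [Projective S.X₂] (M : C) (n : ℕ) :
    Subsingleton (Ext.{v} S.X₃ M (n + 2)) ↔ Subsingleton (Ext.{v} S.X₁ M (n + 1)) := by
  constructor
  · intro h
    refine subsingleton_of_forall_eq 0 fun x => ?_
    obtain ⟨y, rfl⟩ := Ext.contravariant_sequence_exact₁ hS M x (n₁ := n + 2) (by lia)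
      (Subsingleton.elim _ _)
    rw [Ext.eq_zero_of_projective y, Ext.comp_zero]
  · intro h
    refine subsingleton_of_forall_eq 0 fun x => ?_
    obtain ⟨y, rfl⟩ := Ext.contravariant_sequence_exact₃ hS M x
      (Ext.eq_zero_of_projective _) (n₀ := n + 1) (by lia)
    rw [Subsingleton.elim y 0, Ext.comp_zero]

theorem Retract.subsingleton_ext_left {X Y : C} (h : Retract X Y) (M : C) (n : ℕ)
    (hY : Subsingleton (Ext.{v} Y M n)) : Subsingleton (Ext.{v} X M n) := by
  refine subsingleton_of_forall_eq 0 fun x => ?_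
  rw [← Ext.mk₀_id_comp x, ← h.retract, ← Ext.mk₀_comp_mk₀_assoc,
    Subsingleton.elim ((Ext.mk₀ h.r).comp x (zero_add n)) 0, Ext.comp_zero]

theorem Retract.subsingleton_ext_right {M N : C} (h : Retract M N) (X : C) (n : ℕ)
    (hN : Subsingleton (Ext.{v} X N n)) : Subsingleton (Ext.{v} X M n) := by
  refine subsingleton_of_forall_eq 0 fun x => ?_
  rw [← Ext.comp_mk₀_id x, ← h.retract, ← Ext.mk₀_comp_mk₀,
    ← Ext.comp_assoc_of_second_deg_zero, Subsingleton.elim (x.comp (Ext.mk₀ h.i) (add_zero n)) 0,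
    Ext.zero_comp]

/-- The identity of N factors through a finite power of M; working componentwise avoids forming that
power. -/
theorem Abelian.Ext.subsingleton_of_sum_eq_id {M N X : C} (n : ℕ) {ι : Type*} [Fintype ι]
    (a : ι → (N ⟶ M)) (b : ι → (M ⟶ N)) (h : ∑ i, a i ≫ b i = 𝟙 N)
    (hM : Subsingleton (Ext.{v} X M n)) : Subsingleton (Ext.{v} X N n) := by
  refine subsingleton_of_forall_eq 0 fun x => ?_
  rw [← Ext.comp_mk₀_id x, ← h, Ext.mk₀_sum, Ext.comp_sum]
  refine Finset.sum_eq_zero fun i _ => ?_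
  rw [← Ext.mk₀_comp_mk₀, ← Ext.comp_assoc_of_second_deg_zero,
    Subsingleton.elim (x.comp (Ext.mk₀ (a i)) (add_zero n)) 0, Ext.zero_comp]

variable {D : Type*} [Category.{v} D] [Abelian D] [HasExt.{v} D] [EnoughProjectives C]
  {F : C ⥤ D} {G : D ⥤ C}

omit [HasExt.{v} C] [HasExt.{v} D] in
theorem Functor.hasProjectiveDimensionLE_obj [F.Additive] [PreservesFiniteLimits F]
    [PreservesFiniteColimits F] [F.PreservesProjectiveObjects] (n : ℕ) (X : C)
    (hX : HasProjectiveDimensionLE X n) : HasProjectiveDimensionLE (F.obj X) n := by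
  induction n generalizing X with
  | zero =>
    rw [← projective_iff_hasProjectiveDimensionLE_zero] at hX ⊢
    exact F.projective_obj X
  | succ n ih =>
    let S : ShortComplex C := ShortComplex.mk (kernel.ι (Projective.π X)) (Projective.π X) (by simp)
    have hS : S.ShortExact := { exact := ShortComplex.exact_kernel _ }
    have : Projective S.X₂ := inferInstanceAs (Projective (Projective.over X))
    have : Projective (S.map F).X₂ := F.projective_obj S.X₂
    exact ((hS.map_of_exact F).hasProjectiveDimensionLT_X₃_iff n this).2
      (ih _ ((hS.hasProjectiveDimensionLT_X₃_iff n inferInstance).1 hX))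

/-- F takes a projective presentation of X to one of F X. In degree one, vanishing is an extension
property that transposes along the adjunction; higher degrees reduce to it by passing to syzygies.
-/
theorem Adjunction.subsingleton_ext_iff (adj : F ⊣ G) [F.Additive] [PreservesFiniteLimits F]
    [PreservesFiniteColimits F] [F.PreservesProjectiveObjects] (n : ℕ) (X : C) (M : D) :
    Subsingleton (Ext.{v} (F.obj X) M (n + 1)) ↔ Subsingleton (Ext.{v} X (G.obj M) (n + 1)) := by
  let S : ShortComplex C := ShortComplex.mk (kernel.ι (Projective.π X)) (Projective.π X) (by simp)
  have hS : S.ShortExact := { exact := ShortComplex.exact_kernel _ }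
  have : Projective S.X₂ := inferInstanceAs (Projective (Projective.over X))
  have : Projective (S.map F).X₂ := F.projective_obj S.X₂
  have hS' := hS.map_of_exact F
  induction n generalizing X with
  | zero =>
    refine (hS'.subsingleton_ext_one_iff M).trans
      (Iff.trans ?_ (hS.subsingleton_ext_one_iff (G.obj M)).symm)
    constructor
    · intro h f
      obtain ⟨g, hg⟩ := h ((adj.homEquiv _ _).symm f)
      exact ⟨adj.homEquiv _ _ g, (adj.homEquiv_naturality_left S.f g).symm.trans
        ((Equiv.eq_symm_apply _).1 hg)⟩
    · intro h f
      obtain ⟨g, hg⟩ := h (adj.homEquiv _ _ f)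
      exact ⟨(adj.homEquiv _ _).symm g, (adj.homEquiv_naturality_left_symm S.f g).symm.trans
        ((Equiv.symm_apply_eq _).2 hg)⟩
  | succ n ih =>
    refine (hS'.subsingleton_ext_succ_iff M n).trans
      (Iff.trans ?_ (hS.subsingleton_ext_succ_iff (G.obj M) n).symm)
    let T : ShortComplex C :=
      ShortComplex.mk (kernel.ι (Projective.π S.X₁)) (Projective.π S.X₁) (by simp)
    have hT : T.ShortExact := { exact := ShortComplex.exact_kernel _ }
    exact ih S.X₁ hT (inferInstanceAs (Projective (Projective.over S.X₁)))
      (F.projective_obj T.X₂) (hT.map_of_exact F)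

end CategoryTheory

/-! ### Restriction of scalars. -/

namespace SmashExtension

variable {R S ι : Type u} [Ring R] [Ring S] [Fintype ι] [DecidableEq ι] (D : SmashExtension R S ι)

section Restriction

variable {M : Type u} [AddCommGroup M] [Module R M] [Module S M]

include D in
theorem free_and_finite [Module R S] (hS : ∀ (r : R) (s : S), D.φ r * s = r • s) :
    Module.Free R S ∧ Module.Finite R S :=
  ⟨.of_equiv (D.coeffEquiv hS).symm, .equiv (D.coeffEquiv hS).symm⟩

theorem finite_iff (hM : ∀ (r : R) (m : M), D.φ r • m = r • m) :
    Module.Finite R M ↔ Module.Finite S M := by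
  let : Module R S := Module.compHom S D.φ
  have hS : ∀ (r : R) (s : S), D.φ r * s = r • s := fun _ _ => rfl
  have : IsScalarTower R S M := ⟨fun r s m => by rw [← hS, mul_smul, hM]⟩
  constructor
  · intro h
    exact Module.Finite.of_restrictScalars_finite R S M
  · intro h
    have := (D.free_and_finite hS).2
    exact Module.Finite.trans S M

theorem projective_restrict (hM : ∀ (r : R) (m : M), D.φ r • m = r • m) [Module.Projective S M] :
    Module.Projective R M := by
  let : Module R S := Module.compHom S D.φ
  have hS : ∀ (r : R) (s : S), D.φ r * s = r • s := fun _ _ => rfl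
  have : IsScalarTower R S M := ⟨fun r s m => by rw [← hS, mul_smul, hM]⟩
  have : IsScalarTower R S S := ⟨fun r s t => mul_assoc (D.φ r) s t⟩
  have := (D.free_and_finite hS).1
  obtain ⟨s, hs⟩ := Module.projective_def'.1 ‹Module.Projective S M›
  refine Module.Projective.of_split (s.restrictScalars R)
    ((Finsupp.linearCombination S (id : M → M)).restrictScalars R) ?_
  ext x
  exact LinearMap.congr_fun hs x

theorem isFinitelyPresentedOfOrder_restrict {n : ℕ} (hM : ∀ (r : R) (m : M), D.φ r • m = r • m)
    (h : IsFinitelyPresentedOfOrder S n M) : IsFinitelyPresentedOfOrder R n M := by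
  obtain ⟨F, d, ε, hF, hε, h0, h1⟩ := h
  refine ⟨fun i => (ModuleCat.restrictScalars D.φ).obj (F i),
    fun i => ((ModuleCat.restrictScalars D.φ).map (ModuleCat.ofHom (d i))).hom,
    { toFun := ε, map_add' := map_add ε, map_smul' := fun r x => ?_ }, fun i hi => ⟨?_, ?_⟩,
    hε, h0, h1⟩
  · exact (map_smul ε (D.φ r) _).trans (hM r _)
  · let : Module R (F i) := Module.compHom _ D.φ
    exact (D.finite_iff (M := F i) (fun _ _ => rfl)).2 (hF i hi).1
  · let : Module R (F i) := Module.compHom _ D.φ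
    have := (hF i hi).2
    exact D.projective_restrict (M := F i) (fun _ _ => rfl)

/-- A resolution over R carries no S-action, so one is built anew over S. A finite free S-module
stays finitely generated projective over R, so `IsFinitelyPresentedOfOrder.ker` controls the kernel
and the induction continues. -/
theorem isFinitelyPresentedOfOrder_of_restrict {n : ℕ}
    (hM : ∀ (r : R) (m : M), D.φ r • m = r • m)
    (h : IsFinitelyPresentedOfOrder R n M) : IsFinitelyPresentedOfOrder S n M := by
  induction n generalizing M with
  | zero =>
    rw [isFinitelyPresentedOfOrder_zero_iff] at h ⊢
    exact (D.finite_iff hM).1 h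
  | succ n ih =>
    have := (D.finite_iff hM).1 h.finite
    obtain ⟨k, g, hg⟩ := Module.Finite.exists_fin' S M
    let P : ModuleCat.{u} S := .of S (Fin k → S)
    have : Module.Finite S P := inferInstanceAs (Module.Finite S (Fin k → S))
    have : Module.Projective S P := inferInstanceAs (Module.Projective S (Fin k → S))
    let : Module R P := Module.compHom P D.φ
    have hP : ∀ (r : R) (x : P), D.φ r • x = r • x := fun _ _ => rfl
    have : Module.Finite R P := (D.finite_iff hP).2 inferInstance
    have : Module.Projective R P := D.projective_restrict hP
    let g' : P →ₗ[R] M :=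
      { toFun := g, map_add' := map_add g,
        map_smul' := fun r x => (map_smul g (D.φ r) x).trans (hM r _) }
    let : Module R (LinearMap.ker g) := Module.compHom _ D.φ
    let e : LinearMap.ker g' ≃ₗ[R] LinearMap.ker g :=
      { toFun := fun x => ⟨x.1, x.2⟩, invFun := fun x => ⟨x.1, x.2⟩, map_add' := fun _ _ => rfl,
        map_smul' := fun _ _ => rfl, left_inv := fun _ => rfl, right_inv := fun _ => rfl }
    exact isFinitelyPresentedOfOrder_succ_of_surjective (P := P) g hg
      (ih (fun _ _ => rfl) ((h.ker g' hg).of_linearEquiv e))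

include D in
theorem isLeftNCoherentRing {n : ℕ} (h : IsLeftNCoherentRing R n) : IsLeftNCoherentRing S n := by
  intro M hM
  let : Module R M := Module.compHom M D.φ
  exact D.isFinitelyPresentedOfOrder_of_restrict (M := M) (fun _ _ => rfl)
    (h (.of R M) (D.isFinitelyPresentedOfOrder_restrict (M := M) (fun _ _ => rfl) hM))

include D in
-- Maschke's argument: an R-linear projection of S onto a left ideal averages to an S-linear one,
-- still the identity on the ideal.
theorem isSemisimpleRing (h : IsSemisimpleRing R) : IsSemisimpleRing S := by
  refine (isSemisimpleModule_iff S S).2 ⟨fun I => ?_⟩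
  let : Module R S := Module.compHom S D.φ
  let : Module R I := Module.compHom I D.φ
  let i : I →ₗ[R] S :=
    { toFun := Subtype.val, map_add' := fun _ _ => rfl, map_smul' := fun _ _ => rfl }
  obtain ⟨f, hf⟩ := IsSemisimpleModule.extension_property i Subtype.val_injective LinearMap.id
  let g : S →ₗ[S] I := D.average (fun _ _ => rfl) (fun _ _ => rfl) f
  refine ⟨_, LinearMap.isCompl_of_proj (f := g) fun x => ?_⟩
  have key : ∀ k, f (D.p k • (x : S)) = D.p k • x := fun k => LinearMap.congr_fun hf (D.p k • x)
  change ∑ k, D.p k • f (D.p k • (x : S)) = x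
  simp only [key, ← mul_smul, D.p_mul_p, if_true]
  rw [← Finset.sum_smul, D.sum_p, one_smul]

end Restriction

/-! ### Induction as an exact left adjoint of restriction. -/

section Functors

/-- Restriction of scalars to `R`. -/
noncomputable abbrev res : ModuleCat.{u} S ⥤ ModuleCat.{u} R := ModuleCat.restrictScalars D.φ

/-- The induction functor. -/
noncomputable def ind : ModuleCat.{u} R ⥤ ModuleCat.{u} S where
  obj N := .of S (D.Ind N)
  map f := ModuleCat.ofHom (Ind.map D f.hom)

/-- Induction is left adjoint to restriction. -/
noncomputable def indAdjunction : D.ind ⊣ D.res :=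
  Adjunction.mkOfHomEquiv
    { homEquiv := fun N M =>
        { toFun := fun f => ModuleCat.ofHom (X := N) (Y := D.res.obj M)
            { toFun := fun n => f.hom (Ind.const D n)
              map_add' := fun x y => map_add f.hom (Ind.const D x) (Ind.const D y)
              map_smul' := fun r x => (congrArg f.hom (Ind.const_smul D r x)).trans
                (map_smul f.hom (D.φ r) (Ind.const D x)) }
          invFun := fun f => ModuleCat.ofHom (X := D.Ind N) (Y := M)
            (Ind.lift D (M := D.res.obj M) (fun _ _ => rfl) f.hom)
          left_inv := fun f => by
            ext (n : D.Ind N)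
            refine Eq.trans (Finset.sum_congr rfl fun i _ =>
              (map_smul f.hom (D.p i) (Ind.const D (n i))).symm) ?_
            refine (map_sum f.hom (fun i => D.p i • Ind.const D (n i)) _).symm.trans ?_
            exact congrArg f.hom (Ind.sum_p_smul_const D n)
          right_inv := fun f => by
            ext n
            exact Ind.lift_const D (M := D.res.obj M) (fun _ _ => rfl) f.hom n }
      homEquiv_naturality_left_symm := fun _ _ => rfl
      homEquiv_naturality_right := fun _ _ => rfl }

instance : D.ind.Additive where
  map_add := rfl

theorem shortExact_map_ind (T : ShortComplex (ModuleCat.{u} R)) (hT : T.ShortExact) :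
    (T.map D.ind).ShortExact := by
  refine ModuleCat.shortComplex_shortExact _ ?_ ?_ ?_
  · intro (x : ι → T.X₂)
    constructor
    · intro hx
      have : ∀ i, ∃ y, T.f y = x i := fun i =>
        (T.moduleCat_exact_iff.1 hT.exact) (x i) (congrFun hx i)
      choose y hy using this
      exact ⟨y, funext hy⟩
    · rintro ⟨y, rfl⟩
      funext i
      exact T.moduleCat_zero_apply _
  · intro x y h
    funext i
    exact hT.moduleCat_injective_f (congrFun h i)
  · intro (x : ι → T.X₃)
    choose y hy using fun i => hT.moduleCat_surjective_g (x i)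
    exact ⟨y, funext hy⟩

theorem preservesFiniteLimits_and_colimits_ind :
    Limits.PreservesFiniteLimits D.ind ∧ Limits.PreservesFiniteColimits D.ind :=
  ((Functor.exact_tfae D.ind).out 0 3).1 D.shortExact_map_ind

instance : Limits.PreservesFiniteLimits D.ind := D.preservesFiniteLimits_and_colimits_ind.1

instance : Limits.PreservesFiniteColimits D.ind := D.preservesFiniteLimits_and_colimits_ind.2

instance : D.ind.PreservesProjectiveObjects :=
  Functor.preservesProjectiveObjects_of_adjunction_of_preservesEpimorphisms D.indAdjunction

/-- An `S`-module is a direct summand of the module induced from its restriction. -/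
noncomputable def retractIndRes (M : ModuleCat.{u} S) : Retract M (D.ind.obj (D.res.obj M)) where
  i :=
    let N : ModuleCat R := D.res.obj M
    let : Module S N := inferInstanceAs (Module S M)
    let : Module R (D.Ind N) := Module.compHom _ D.φ
    -- Averaging the unit gives m ↦ ∑ p i ⊗ p i m, an S-linear section of the counit.
    ModuleCat.ofHom (Y := D.Ind N) (D.average (M := N) (N := D.Ind N) (fun _ _ => rfl)
      (fun _ _ => rfl)
      ({ toFun := Ind.const D
         map_add' := fun _ _ => rfl
         map_smul' := Ind.const_smul D } : N →ₗ[R] D.Ind N))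
  r := ModuleCat.ofHom (X := D.Ind (D.res.obj M))
    (Ind.lift D (M := D.res.obj M) (fun _ _ => rfl) LinearMap.id)
  retract := by
    ext m
    change Ind.lift D (M := D.res.obj M) (fun _ _ => rfl) LinearMap.id
      (∑ i, D.p i • (Ind.const D (N := D.res.obj M) (D.p i • m))) = m
    rw [map_sum]
    simp only [map_smul]
    refine (Finset.sum_congr rfl fun i _ => congrArg (D.p i • ·)
      (Ind.lift_const D (M := D.res.obj M) (fun _ _ => rfl) LinearMap.id _)).trans ?_
    change ∑ i, D.p i • D.p i • m = m
    simp only [← mul_smul, D.p_mul_p, if_true]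
    rw [← Finset.sum_smul, D.sum_p, one_smul]

theorem hasProjectiveDimensionLE_of_res (M : ModuleCat.{u} S) (n : ℕ)
    (h : HasProjectiveDimensionLE (D.res.obj M) n) : HasProjectiveDimensionLE M n := by
  have := D.ind.hasProjectiveDimensionLE_obj n _ h
  exact (D.retractIndRes M).hasProjectiveDimensionLT (n + 1)

theorem finite_ind (N : Type u) [AddCommGroup N] [Module R N] [Module.Finite R N] :
    Module.Finite S (D.Ind N) := by
  obtain ⟨t, ht⟩ := Module.Finite.fg_top (R := R) (M := N)
  classical
  refine ⟨t.image (Ind.const D), ?_⟩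
  rw [eq_top_iff]
  intro n _
  rw [← Ind.sum_p_smul_const D n]
  refine Submodule.sum_mem _ fun i _ => Submodule.smul_mem _ _ ?_
  have hx : n i ∈ Submodule.span R (t : Set N) := by rw [ht]; trivial
  generalize n i = x at hx
  induction hx using Submodule.span_induction with
  | mem x hx => exact Submodule.subset_span (by simpa using ⟨x, hx, rfl⟩)
  | zero => exact Submodule.zero_mem _
  | add x y _ _ hx hy => exact Submodule.add_mem _ hx hy
  | smul r x _ hx =>
    rw [Ind.const_smul]
    exact Submodule.smul_mem _ _ hx

theorem isFinitelyPresentedOfOrder_ind {n : ℕ} (N : ModuleCat.{u} R)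
    (h : IsFinitelyPresentedOfOrder R n N) : IsFinitelyPresentedOfOrder S n (D.ind.obj N) := by
  obtain ⟨F, d, ε, hF, hε, h0, h1⟩ := h
  have exact_map : ∀ {A B C : Type u} [AddCommGroup A] [Module R A] [AddCommGroup B] [Module R B]
      [AddCommGroup C] [Module R C] {f : A →ₗ[R] B} {g : B →ₗ[R] C}, Function.Exact f g →
      Function.Exact (Ind.map D f) (Ind.map D g) := by
    intro A B C _ _ _ _ _ _ f g h x
    constructor
    · intro hx
      choose y hy using fun i => (h (x i)).1 (congrFun hx i)
      exact ⟨y, funext hy⟩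
    · rintro ⟨y, rfl⟩
      funext i
      exact (h _).2 ⟨y i, rfl⟩
  refine ⟨fun i => D.ind.obj (F i), fun i => Ind.map D (d i), Ind.map D ε, fun i hi => ⟨?_, ?_⟩,
    ?_, fun hn => exact_map (h0 hn), fun i hi => exact_map (h1 i hi)⟩
  · have := (hF i hi).1
    exact D.finite_ind (F i)
  · have := (hF i hi).2
    have : Projective (F i) := (IsProjective.iff_projective (R := R) (F i)).1 this
    exact (IsProjective.iff_projective (R := S) (D.ind.obj (F i))).2
      (D.ind.projective_obj (F i))
  · intro (x : ι → N)
    choose y hy using fun i => hε (x i)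
    exact ⟨y, funext hy⟩

end Functors

end SmashExtension

namespace SmashExtension

variable {R S ι : Type u} [Ring R] [Ring S] [Fintype ι] [DecidableEq ι] (D : SmashExtension R S ι)

/-! ### Flatness under restriction. -/

section Flat

open TensorProduct

variable {M : Type u} [AddCommGroup M] [Module R M] [Module S M]

theorem balancedTensor_mk_smul {R : Type u} [Ring R] {N M : Type u} [AddCommGroup N]
    [Module Rᵐᵒᵖ N] [AddCommGroup M] [Module R M] (n : N) (r : R) (m : M) :
    (QuotientAddGroup.mk ((MulOpposite.op r • n) ⊗ₜ[ℤ] m) : BalancedTensor R N M) =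
      QuotientAddGroup.mk (n ⊗ₜ[ℤ] (r • m)) := by
  rw [← sub_eq_zero, ← QuotientAddGroup.mk_sub, QuotientAddGroup.eq_zero_iff]
  exact AddSubgroup.subset_closure ⟨n, r, m, rfl⟩

/-- The constant families, as an additive homomorphism. -/
def Ind.constHom (N : Type u) [AddCommGroup N] : N →+ D.Ind N where
  toFun := Ind.const D
  map_zero' := rfl
  map_add' _ _ := rfl

/-- Evaluation at an index, as an additive homomorphism. -/
def Ind.evalHom (N : Type u) [AddCommGroup N] (i : ι) : D.Ind N →+ N where
  toFun ν := ν i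
  map_zero' := rfl
  map_add' _ _ := rfl

/-- The map `N ⊗_R M → Ind N ⊗_S M` sending `n ⊗ m` to `const n ⊗ m`. -/
noncomputable def toBalancedTensorInd (N : Type u) [AddCommGroup N] [Module Rᵐᵒᵖ N]
    (hM : ∀ (r : R) (m : M), D.φ r • m = r • m) :
    BalancedTensor R N M →+ BalancedTensor S (D.op.Ind N) M :=
  QuotientAddGroup.map _ _
    (LinearMap.rTensor M (Ind.constHom D.op N).toIntLinearMap).toAddMonoidHom <| by
    rw [balancedRelations, AddSubgroup.closure_le]
    rintro _ ⟨n, r, m, rfl⟩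
    refine AddSubgroup.subset_closure ⟨Ind.const D.op n, D.φ r, m, ?_⟩
    rw [hM]
    rw [LinearMap.toAddMonoidHom_coe, map_sub]
    exact congrArg (fun x => x ⊗ₜ[ℤ] m - Ind.const D.op n ⊗ₜ[ℤ] (r • m))
      (Ind.const_smul D.op (MulOpposite.op r) n)

/-- The map `Ind N ⊗_S M → N ⊗_R M` sending `ν ⊗ m` to `∑ i, ν i ⊗ p i m`. -/
noncomputable def ofBalancedTensorInd (N : Type u) [AddCommGroup N] [Module Rᵐᵒᵖ N]
    (hM : ∀ (r : R) (m : M), D.φ r • m = r • m) :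
    BalancedTensor S (D.op.Ind N) M →+ BalancedTensor R N M :=
  QuotientAddGroup.lift _
    (∑ i, (QuotientAddGroup.mk' (balancedRelations R N M)).comp
      (TensorProduct.map (Ind.evalHom D.op N i).toIntLinearMap
        (DistribSMul.toAddMonoidHom M (D.p i)).toIntLinearMap).toAddMonoidHom) <| by
    rw [balancedRelations, AddSubgroup.closure_le]
    rintro _ ⟨ν, s, m, rfl⟩
    -- These are the coefficients of s in the basis p i on the other side, s = ∑ p i φ (y i).
    let y : ι → R := fun i => (D.op.coeff (MulOpposite.op s) i).unop
    have hy : ∀ i, D.p i * D.φ (y i) = D.p i * s := fun i =>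
      congrArg MulOpposite.unop (D.op.coeff_mul_p (MulOpposite.op s) i)
    have hν : ∀ j, Ind.evalHom D.op N j (MulOpposite.op s • ν) =
        ∑ i, MulOpposite.op (D.c i j (y i)) • Ind.evalHom D.op N i ν := fun j => rfl
    rw [SetLike.mem_coe, AddMonoidHom.mem_ker, map_sub, sub_eq_zero]
    simp only [AddMonoidHom.finsetSum_apply, AddMonoidHom.comp_apply,
      LinearMap.toAddMonoidHom_coe, TensorProduct.map_tmul, AddMonoidHom.coe_toIntLinearMap,
      DistribSMul.toAddMonoidHom_apply, hν, TensorProduct.sum_tmul, map_sum,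
      QuotientAddGroup.mk'_apply, balancedTensor_mk_smul]
    rw [Finset.sum_comm]
    refine Finset.sum_congr rfl fun i _ => ?_
    have h1 : ∑ j, D.c i j (y i) • D.p j • m = D.p i • s • m := by
      simp only [← hM, ← mul_smul, ← D.p_mul_mul_p, ← hy]
      rw [← Finset.sum_smul, ← Finset.mul_sum, D.sum_p, mul_one]
    rw [← h1, TensorProduct.tmul_sum, QuotientAddGroup.mk_sum]

/-- N ⊗_R M embeds naturally in (N ⊗_R S) ⊗_S M, and right induction preserves injections. A
one-sided inverse of the comparison map is enough. -/
theorem isFlatModule_restrict (hM : ∀ (r : R) (m : M), D.φ r • m = r • m)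
    (h : IsFlatModule S M) : IsFlatModule R M := by
  intro N N' _ _ _ _ f hf
  have key := h (D.op.Ind N) (D.op.Ind N') (Ind.map D.op f) fun x y hxy =>
    funext fun i => hf (congrFun hxy i)
  have left_inv : ∀ x, D.ofBalancedTensorInd N hM (D.toBalancedTensorInd N hM x) = x := by
    intro x
    obtain ⟨t, rfl⟩ := QuotientAddGroup.mk_surjective x
    induction t with
    | zero => rw [QuotientAddGroup.mk_zero, map_zero, map_zero]
    | add a b ha hb => rw [QuotientAddGroup.mk_add, map_add, map_add, ha, hb]
    | tmul n m =>
      change (∑ i, (QuotientAddGroup.mk' (balancedRelations R N M)).comp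
        (TensorProduct.map (Ind.evalHom D.op N i).toIntLinearMap
        (DistribSMul.toAddMonoidHom M (D.p i)).toIntLinearMap).toAddMonoidHom)
          (Ind.const D.op n ⊗ₜ[ℤ] m) = _
      rw [AddMonoidHom.finsetSum_apply]
      change ∑ i, (QuotientAddGroup.mk (n ⊗ₜ[ℤ] (D.p i • m)) : BalancedTensor R N M) = _
      rw [← QuotientAddGroup.mk_sum, ← TensorProduct.tmul_sum, ← Finset.sum_smul, D.sum_p, one_smul]
  have comm : ∀ x, BalancedTensor.map S M (Ind.map D.op f) (D.toBalancedTensorInd N hM x) =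
      D.toBalancedTensorInd N' hM (BalancedTensor.map R M f x) := by
    intro x
    obtain ⟨t, rfl⟩ := QuotientAddGroup.mk_surjective x
    induction t with
    | zero => simp only [QuotientAddGroup.mk_zero, map_zero]
    | add a b ha hb => simp only [QuotientAddGroup.mk_add, map_add, ha, hb]
    | tmul n m => rfl
  intro x y hxy
  rw [← left_inv x, ← left_inv y]
  refine congrArg _ (key ?_)
  rw [comm, comm, hxy]

include D in
theorem isLeftNPerfectRing {n : ℕ} (h : IsLeftNPerfectRing R n) : IsLeftNPerfectRing S n := by
  intro M hM
  let : Module R M := Module.compHom M D.φ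
  exact D.hasProjectiveDimensionLE_of_res M n (h _ (D.isFlatModule_restrict (M := M)
    (fun _ _ => rfl) hM))

end Flat

include D in
theorem isLeftNDRing {n d : ℕ} (h : IsLeftNDRing R n d) : IsLeftNDRing S n d := by
  intro M hM
  let : Module R M := Module.compHom M D.φ
  exact D.hasProjectiveDimensionLE_of_res M d (h _ (D.isFinitelyPresentedOfOrder_restrict (M := M)
    (fun _ _ => rfl) hM))

/-! ### Ascent and descent of coherence. -/

section Coherent

/-- A left ideal of `S` embeds into a finite free `R`-module. -/
theorem exists_injective_ideal (I : Ideal S) [Module R I]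
    (hI : ∀ (r : R) (x : I), D.φ r • x = r • x) :
    ∃ f : I →ₗ[R] (ι → R), Function.Injective f := by
  let : Module R S := Module.compHom S D.φ
  refine ⟨(D.coeffEquiv fun _ _ => rfl).toLinearMap ∘ₗ
    { toFun := Subtype.val, map_add' := fun _ _ => rfl,
      map_smul' := fun r x => congrArg Subtype.val (hI r x).symm }, ?_⟩
  exact (D.coeffEquiv fun _ _ => rfl).injective.comp Subtype.val_injective

include D in
-- Over R the ideal is a finitely generated submodule of a finite free module, hence finitely
-- presented. The kernel of a finite free S-presentation is then finitely generated over R, and so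
-- over S.
theorem isLeftCoherentRing (h : IsLeftCoherentRing R) : IsLeftCoherentRing S := by
  intro I hI
  have hSI : Module.Finite S I := Module.Finite.iff_fg.2 hI
  let : Module R I := Module.compHom I D.φ
  have hRI : ∀ (r : R) (x : I), D.φ r • x = r • x := fun _ _ => rfl
  have : Module.Finite R I := (D.finite_iff hRI).2 hSI
  obtain ⟨f, hf⟩ := D.exists_injective_ideal I hRI
  have := h.finitePresentation f hf
  obtain ⟨k, g, hg⟩ := Module.Finite.exists_fin' S I
  let : Module R (Fin k → S) := Module.compHom _ D.φ
  have hRk : ∀ (r : R) (x : Fin k → S), D.φ r • x = r • x := fun _ _ => rfl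
  let g' : (Fin k → S) →ₗ[R] I :=
    { toFun := g, map_add' := map_add g, map_smul' := fun r x => map_smul g (D.φ r) x }
  have := (D.finite_iff (M := Fin k → S) hRk).2 inferInstance
  have hk : Module.Finite R (LinearMap.ker g') :=
    Module.Finite.iff_fg.2 (Module.FinitePresentation.fg_ker g' hg)
  let : Module R (LinearMap.ker g) := Module.compHom _ D.φ
  let e : LinearMap.ker g' ≃ₗ[R] LinearMap.ker g :=
    { toFun := fun x => ⟨x.1, x.2⟩, invFun := fun x => ⟨x.1, x.2⟩, map_add' := fun _ _ => rfl,
      map_smul' := fun _ _ => rfl, left_inv := fun _ => rfl, right_inv := fun _ => rfl }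
  have := (D.finite_iff (M := LinearMap.ker g) (fun _ _ => rfl)).1 (.equiv e)
  exact Module.finitePresentation_of_surjective g hg (Module.Finite.iff_fg.1 this)

include D in
theorem isLeftRegularCoherentRing (h : IsLeftRegularCoherentRing R) :
    IsLeftRegularCoherentRing S := by
  refine ⟨fun I hI => ?_, D.isLeftCoherentRing h.2⟩
  have hSI : Module.Finite S I := Module.Finite.iff_fg.2 hI
  let : Module R I := Module.compHom I D.φ
  have hRI : ∀ (r : R) (x : I), D.φ r • x = r • x := fun _ _ => rfl
  have : Module.Finite R I := (D.finite_iff hRI).2 hSI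
  obtain ⟨f, hf⟩ := D.exists_injective_ideal I hRI
  obtain ⟨d, hd⟩ := h.exists_projectiveDimension (.of R I) f hf
  exact ⟨d, D.hasProjectiveDimensionLE_of_res (.of S I) d hd⟩

theorem finitePresentation_of_ind [Nonempty ι] (N : Type u) [AddCommGroup N] [Module R N]
    [Module.Finite R N] [Module.FinitePresentation S (D.Ind N)] :
    Module.FinitePresentation R N := by
  obtain ⟨k, f, hf⟩ := Module.Finite.exists_fin' R N
  refine Module.finitePresentation_of_surjective f hf ?_
  have := D.finite_ind (Fin k → R)
  have hsurj : Function.Surjective (Ind.map D f) := fun x => by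
    choose y hy using fun i => hf (x i)
    exact ⟨y, funext hy⟩
  obtain ⟨t, ht⟩ := Module.FinitePresentation.fg_ker (Ind.map D f) hsurj
  classical
  -- All entries of generators of the induced kernel. The S-action only forms R-combinations of
  -- entries, so any entry of a constant family from the kernel lies in their span.
  let T : Finset (Fin k → R) := t.biUnion fun x => Finset.univ.image fun i => x i
  refine ⟨T, le_antisymm (Submodule.span_le.2 ?_) ?_⟩
  · intro x hx
    obtain ⟨y, hy, i, rfl⟩ : ∃ y ∈ t, ∃ i, y i = x := by simpa [T] using hx
    have : y ∈ LinearMap.ker (Ind.map D f) := ht ▸ Submodule.subset_span hy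
    exact congrFun this i
  · intro x hx
    have hx' : Ind.const D x ∈ Submodule.span S (t : Set (D.Ind (Fin k → R))) := by
      rw [ht]
      exact funext fun _ => hx
    have key : ∀ z ∈ Submodule.span S (t : Set (D.Ind (Fin k → R))), ∀ i,
        z i ∈ Submodule.span R (T : Set (Fin k → R)) := by
      intro z hz
      induction hz using Submodule.span_induction with
      | mem z hz =>
        exact fun i => Submodule.subset_span (by simpa [T] using ⟨z, hz, i, rfl⟩)
      | zero => exact fun i => Submodule.zero_mem _
      | add x y _ _ hx hy => exact fun i => Submodule.add_mem _ (hx i) (hy i)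
      | smul s x _ hx =>
        exact fun i => Submodule.sum_mem _ fun j _ => Submodule.smul_mem _ _ (hx j)
    exact key _ hx' (Classical.arbitrary ι)

include D in
theorem isLeftCoherentRing_of [Nonempty ι] (h : IsLeftCoherentRing S) : IsLeftCoherentRing R := by
  intro I hI
  have : Module.Finite R I := Module.Finite.iff_fg.2 hI
  have := D.finite_ind I
  let : Module R S := Module.compHom S D.φ
  let f : D.Ind I →ₗ[S] S := Ind.lift D (fun _ _ => rfl)
    { toFun := fun x => D.φ x, map_add' := fun x y => by simp, map_smul' := fun r x => by
        change D.φ (r * x) = D.φ r * D.φ x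
        simp }
  -- The map is (x i) ↦ ∑ p i φ (x i), so freeness on the other side applies; it identifies the
  -- induced module with a left ideal of S.
  have hf : Function.Injective f := by
    intro x y hxy
    have := D.right_bijective.1 (a₁ := fun i => (x i : R)) (a₂ := fun i => (y i : R)) hxy
    exact funext fun i => Subtype.ext (congrFun this i)
  have := h _ (Submodule.FG.of_finite (N := LinearMap.range f))
  have := Module.FinitePresentation.of_equiv (LinearEquiv.ofInjective f hf).symm
  exact D.finitePresentation_of_ind I

end Coherent

/-! ### Injective dimension of the regular modules. -/

section InjectiveDimension

open Abelian

/-- By adjunction the left side concerns Ext over R into S, and S is a finite nonempty power of R: R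
is a retract of S, and the coordinates recover S from R. -/
theorem subsingleton_ext_self_iff [Nonempty ι] (n : ℕ) (X : ModuleCat.{u} R) :
    Subsingleton (Ext.{u} (D.ind.obj X) (ModuleCat.of S S) (n + 1)) ↔
      Subsingleton (Ext.{u} X (ModuleCat.of R R) (n + 1)) := by
  rw [D.indAdjunction.subsingleton_ext_iff]
  let : Module R S := Module.compHom S D.φ
  let a (i : ι) : D.res.obj (.of S S) ⟶ .of R R :=
    ModuleCat.ofHom (X := S) (Y := R)
      (LinearMap.proj i ∘ₗ (D.coeffEquiv (fun _ _ => rfl)).toLinearMap)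
  let b (i : ι) : ModuleCat.of R R ⟶ D.res.obj (.of S S) :=
    ModuleCat.ofHom (X := R) (Y := S) (LinearMap.toSpanSingleton R S (D.p i))
  have hba : ∀ i, b i ≫ a i = 𝟙 _ := by
    intro i
    ext
    refine D.coeff_eq ?_
    change D.φ 1 * D.p i * D.p i = D.φ 1 * D.p i
    rw [mul_assoc, D.p_mul_p, if_pos rfl]
  have hab : ∑ i, a i ≫ b i = 𝟙 _ := by
    ext s
    rw [ModuleCat.hom_sum, LinearMap.sum_apply]
    exact D.sum_coeff s
  exact ⟨Retract.subsingleton_ext_right ⟨b (Classical.arbitrary ι), a _, hba _⟩ X _,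
    Ext.subsingleton_of_sum_eq_id _ a b hab⟩

include D in
theorem hasNInjectiveDimension_iff [Nonempty ι] (n k : ℕ) :
    HasNInjectiveDimension R n (.of R R) k ↔ HasNInjectiveDimension S n (.of S S) k := by
  unfold HasNInjectiveDimension
  have : {j : ℕ | ∀ F : ModuleCat.{u} R, IsFinitelyPresentedOfOrder R n F →
      Subsingleton (Ext.{u} F (ModuleCat.of R R) (j + 1))} =
    {j : ℕ | ∀ F : ModuleCat.{u} S, IsFinitelyPresentedOfOrder S n F →
      Subsingleton (Ext.{u} F (ModuleCat.of S S) (j + 1))} := by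
    ext j
    constructor
    · intro h F hF
      -- F need not be induced, but it is a summand of the module induced from its restriction.
      refine (D.retractIndRes F).subsingleton_ext_left _ _
        ((D.subsingleton_ext_self_iff j _).2 (h _ ?_))
      let : Module R F := Module.compHom F D.φ
      exact D.isFinitelyPresentedOfOrder_restrict (M := F) (fun _ _ => rfl) hF
    · intro h F hF
      exact (D.subsingleton_ext_self_iff j F).1 (h _ (D.isFinitelyPresentedOfOrder_ind F hF))
  rw [this]

theorem hasNInjectiveDimension_congr {R : Type u} [Ring R] {M N : ModuleCat.{u} R} (e : M ≅ N)
    (n k : ℕ) : HasNInjectiveDimension R n M k ↔ HasNInjectiveDimension R n N k := by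
  unfold HasNInjectiveDimension
  have : ∀ (F : ModuleCat.{u} R) (j : ℕ), Subsingleton (Ext.{u} F M j) ↔
      Subsingleton (Ext.{u} F N j) := fun F j =>
    ⟨e.symm.retract.subsingleton_ext_right F j, e.retract.subsingleton_ext_right F j⟩
  simp only [this]

/-- The right regular module over a ring as the left regular module over the opposite ring. -/
def opSelfIso (R : Type u) [Ring R] : ModuleCat.of Rᵐᵒᵖ R ≅ ModuleCat.of Rᵐᵒᵖ Rᵐᵒᵖ :=
  LinearEquiv.toModuleIso
    { MulOpposite.opAddEquiv with
      map_smul' := fun _ _ => rfl }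

include D in
theorem isFCRing_iff [Nonempty ι] (n : ℕ) : IsFCRing R n ↔ IsFCRing S n := by
  unfold IsFCRing
  rw [D.hasNInjectiveDimension_iff, hasNInjectiveDimension_congr (opSelfIso R),
    hasNInjectiveDimension_congr (opSelfIso S), D.op.hasNInjectiveDimension_iff]
  have h1 : IsLeftCoherentRing R ↔ IsLeftCoherentRing S :=
    ⟨D.isLeftCoherentRing, D.isLeftCoherentRing_of⟩
  have h2 : IsLeftCoherentRing Rᵐᵒᵖ ↔ IsLeftCoherentRing Sᵐᵒᵖ :=
    ⟨D.op.isLeftCoherentRing, D.op.isLeftCoherentRing_of⟩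
  rw [h1, h2]

end InjectiveDimension

end SmashExtension

/-! ### The smash product as such an extension. -/

namespace SmashProduct

variable {R G : Type u} [Ring R] [Group G] [Fintype G] [DecidableEq G]
  (𝒜 : Additive G → AddSubgroup R) [GradedRing 𝒜]

theorem sum_gradedComponent_mul_inv (h : G) (r : R) :
    ∑ g, gradedComponent 𝒜 (g * h⁻¹) r = r :=
  (Fintype.sum_equiv (Equiv.mulRight h⁻¹) _ (fun g => gradedComponent 𝒜 g r)
    (fun _ => rfl)).trans (sum_gradedComponent 𝒜 r)

theorem sum_gradedComponent_mul_inv' (g : G) (r : R) :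
    ∑ h, gradedComponent 𝒜 (g * h⁻¹) r = r :=
  (Fintype.sum_equiv ((Equiv.inv G).trans (Equiv.mulLeft g)) _ (fun g => gradedComponent 𝒜 g r)
    (fun _ => rfl)).trans (sum_gradedComponent 𝒜 r)

omit [Fintype G] in
theorem gradedComponent_gradedComponent (g h : G) (r : R) :
    gradedComponent 𝒜 g (gradedComponent 𝒜 h r) = if g = h then gradedComponent 𝒜 h r else 0 := by
  have hr := gradedComponent_mem 𝒜 h r
  rw [gradedComponent, GradedRing.proj_apply]
  split_ifs with hgh
  · subst hgh
    exact DirectSum.decompose_of_mem_same 𝒜 hr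
  · exact DirectSum.decompose_of_mem_ne 𝒜 hr fun h0 => hgh (Additive.ofMul.injective h0).symm

theorem coeff_sum {κ : Type*} (t : Finset κ) (x : κ → SmashProduct 𝒜) (g : G) :
    (∑ k ∈ t, x k).coeff g = ∑ k ∈ t, (x k).coeff g :=
  map_sum ({ toFun := fun y => y.coeff g, map_zero' := rfl, map_add' := fun _ _ => rfl } :
    SmashProduct 𝒜 →+ R) x t

theorem mk_mul (r : R) (x : SmashProduct 𝒜) : (⟨fun _ => r⟩ : SmashProduct 𝒜) * x = r • x := by
  ext h
  rw [coeff_mul]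
  simp only [← Finset.mul_sum, sum_gradedComponent_mul_inv, coeff_smul, Pi.smul_apply, smul_eq_mul]

/-- The embedding `r ↦ ∑ g, r p_g` of a graded ring into its smash product. -/
def incl : R →+* SmashProduct 𝒜 where
  toFun r := ⟨fun _ => r⟩
  map_one' := rfl
  map_zero' := rfl
  map_add' _ _ := rfl
  map_mul' r r' := (mk_mul 𝒜 r ⟨fun _ => r'⟩).symm

@[simp] theorem incl_coeff (r : R) (g : G) : (incl 𝒜 r).coeff g = r := rfl

theorem incl_mul (r : R) (x : SmashProduct 𝒜) : incl 𝒜 r * x = r • x := mk_mul 𝒜 r x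

theorem p_mul_incl_coeff (g : G) (r : R) (h : G) :
    (p 𝒜 g * incl 𝒜 r).coeff h = gradedComponent 𝒜 (g * h⁻¹) r := by
  rw [coeff_mul]
  simp [p, Pi.single_apply]

theorem sum_incl_mul_p (x : G → R) : ∑ g, incl 𝒜 (x g) * p 𝒜 g = ⟨x⟩ := by
  ext h
  simp [coeff_sum, incl_mul, p, Pi.single_apply]

theorem sum_p_mul_incl_coeff (x : G → R) (h : G) :
    (∑ g, p 𝒜 g * incl 𝒜 (x g)).coeff h = ∑ g, gradedComponent 𝒜 (g * h⁻¹) (x g) := by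
  simp only [coeff_sum, p_mul_incl_coeff]

/-- The smash product as an extension of `R`. -/
def smashExtension : SmashExtension R (SmashProduct 𝒜) G where
  φ := incl 𝒜
  p := p 𝒜
  c g h r := gradedComponent 𝒜 (g * h⁻¹) r
  p_mul_p g h := by
    have := smul_p_mul_smul_p 𝒜 1 1 g h
    simp only [one_smul, one_mul] at this
    rw [this, gradedComponent_one]
    by_cases hgh : g = h
    · simp [hgh]
    · simp [hgh, mul_inv_eq_one]
  sum_p := by
    have := sum_incl_mul_p 𝒜 (fun _ => 1)
    simp only [map_one, one_mul] at this
    exact this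
  left_bijective := by
    simp only [sum_incl_mul_p]
    exact (coeffEquiv 𝒜).symm.bijective
  right_bijective := by
    -- The h-coefficient of ∑ p g x_g is ∑ over g of (x_g)_{gh⁻¹}. The inverse regroups homogeneous
    -- pieces: the piece of y_h of degree gh⁻¹ goes to x_g.
    refine Function.bijective_iff_has_inverse.2
      ⟨fun y g => ∑ h, gradedComponent 𝒜 (g * h⁻¹) (y.coeff h), fun x => ?_, fun y => ?_⟩
    · funext g
      simp [sum_p_mul_incl_coeff, gradedComponent_gradedComponent, sum_gradedComponent_mul_inv']
    · ext h
      rw [sum_p_mul_incl_coeff]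
      simp [gradedComponent_gradedComponent, sum_gradedComponent_mul_inv]
  p_mul_mul_p g h r := by
    have := smul_p_mul_smul_p 𝒜 1 r g h
    rw [mul_assoc, incl_mul, incl_mul]
    simpa using this
  -- A homogeneous element of degree gh⁻¹ turns p h on its right into p g on its left.
  p_mul_c g h r := by
    ext k
    rw [p_mul_incl_coeff, incl_mul, gradedComponent_gradedComponent]
    simp [p, Pi.single_apply]

end SmashProduct

theorem proposition8p3 {R G : Type u} [Ring R] [Group G] [Fintype G] [DecidableEq G]
    (𝒜 : Additive G → AddSubgroup R) [GradedRing 𝒜] :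
    (IsLeftCoherentRing R ↔ IsLeftCoherentRing (SmashProduct 𝒜)) ∧
    (IsDingChenRing R ↔ IsDingChenRing (SmashProduct 𝒜)) ∧
    (∀ n : ℕ, IsLeftNPerfectRing R n → IsLeftNPerfectRing (SmashProduct 𝒜) n) ∧
    (∀ n d : ℕ, IsLeftNDRing R n d → IsLeftNDRing (SmashProduct 𝒜) n d) ∧
    (∀ n : ℕ, IsLeftNCoherentRing R n → IsLeftNCoherentRing (SmashProduct 𝒜) n) ∧
    (IsSemisimpleRing R → IsSemisimpleRing (SmashProduct 𝒜)) ∧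
    (IsLeftRegularCoherentRing R → IsLeftRegularCoherentRing (SmashProduct 𝒜)) :=
  let D := SmashProduct.smashExtension 𝒜
  ⟨⟨D.isLeftCoherentRing, D.isLeftCoherentRing_of⟩, exists_congr D.isFCRing_iff,
    fun _ => D.isLeftNPerfectRing, fun _ _ => D.isLeftNDRing, fun _ => D.isLeftNCoherentRing,
    D.isSemisimpleRing, D.isLeftRegularCoherentRing⟩
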